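/- **Setting.** A mesh $\mathcal T$ on $\Omega$ is a finite set of compact non-degenerate flat triangles in Euclidean space that cover $\overline\Omega$, any two different ones of which are disjoint or meet exactly in a common node or exactly in a common edge; each triangle $T$ carries one of its edges as its *reference edge* $E_T$. *Bisecting* $T$ means joining the midpoint $x_T$ of $E_T$ to the opposite node; the reference edges of the two sons are the edges opposite to $x_T$. A call of NVB takes a set of marked elements, marks their reference edges, then repeatedly marks the reference edge of every element having a marked edge until nothing changes, and finally bisects every element whose reference edge is marked, and then every son whose reference edge is a marked edge (so an element is kept or split into 2, 3 or 4 elements). A call of the modified algorithm MNVB prescribes an arbitrary set of initially marked edges of marked elements, closes it in the same way, and refines as NVB does, except that each element with three marked edges is refined, by free choice, by three bisections, by red refinement (into four similar elements, each with reference edge parallel to $E_T$), or by five bisections (the three bisections, followed by bisection of the two new elements whose common reference edge joins $x_T$ to the node opposite to $E_T$). The level $\mathrm{gen}(T)$ is $0$ on the initial mesh, grows by $1$ in each bisection and by $2$ in red refinement. If an element $T'$ satisfies $T\cap T'=E_T$, then $N(T)=T'$ is the *reference neighbour* of $T$. Two elements sharing an edge $E$ are *compatibly divisible* if $E$ is the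 reference edge of both or of none of them. A *successor* of $\widehat T$ is an element obtained from $\widehat T$ by finitely many (possibly no) bisections; elements are *neighbouring* if they share an edge. **Statement.** Let $\mathcal T_0$ be a mesh with an arbitrary choice of reference edges. For every mesh $\mathcal T_\star$ that is obtained from $\mathcal T_0$ by finitely many calls of NVB, the following hold, where $\mathcal E_0,\mathcal E_\star$ are the sets of edges of $\mathcal T_0,\mathcal T_\star$. (i) There are constants $c,C>0$ depending only on $\mathcal T_0$ such that $c\,2^{-\mathrm{gen}(T)/2}\le |T|^{1/2}\le \mathrm{diam}(T)\le C\,2^{-\mathrm{gen}(T)/2}$ for all $T\in\mathcal T_\star$. (ii) If $T_1,T_2\in\mathcal T_\star$ and $T_1\cap T_2\in\mathcal E_\star$, then $|\mathrm{gen}(T_1)-\mathrm{gen}(T_2)|\le 2$. (iii) If $T\in\mathcal T_\star$ has a reference neighbour $N(T)$ and $\mathrm{gen}(N(T))>\mathrm{gen}(T)$, then $T$ and $N(T)$ are compatibly divisible and $\mathrm{gen}(N(T))=\mathrm{gen}(T)+1$. (iv) Neighbouring successors $T_1,T_2\in\mathcal T_\star$ of one element $\widehat T\in\mathcal T_0$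 with $\mathrm{gen}(T_1)=\mathrm{gen}(T_2)$ are compatibly divisible. (v) If $\widehat T_1,\widehat T_2\in\mathcal T_0$ are compatibly divisible, then neighbouring successors $T_1,T_2\in\mathcal T_\star$ of $\widehat T_1$ and $\widehat T_2$, respectively, with $\mathrm{gen}(T_1)=\mathrm{gen}(T_2)$ are compatibly divisible. (vi) If $T\in\mathcal T_\star$ has a reference neighbour with $\mathrm{gen}(N(T))=\mathrm{gen}(T)$ and $T$, $N(T)$ are not compatibly divisible, then $E_T=T\cap N(T)$ is contained in an edge $E_0\in\mathcal E_0$. (vii) There is a constant $C_{\rm chain}\in\mathbb N$ depending only on $\mathcal T_0$ such that $n\le C_{\rm chain}$ for every sequence $T_1,\dots,T_n$ of pairwise different elements of $\mathcal T_\star$ of equal level with $T_j=N(T_{j-1})$ for $j=2,\dots,n$. Moreover, (i) and (ii) hold as well for every $\mathcal T_\star$ that is obtained from $\mathcal T_0$ by finitely many calls of MNVB. -/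

import Mathlib

open MeasureTheory

noncomputable section

namespace NVB

/-- A point of `d`-dimensional Euclidean space (`d = 2` for planar meshes, `d = 3` for meshes on
surfaces). -/
abbrev Point (d : ℕ) := EuclideanSpace ℝ (Fin d)

/-- An edge, given by its unordered pair of end points. -/
abbrev Edge (d : ℕ) := Sym2 (Point d)

/-- The segment that an edge stands for. -/
def Edge.carrier {d : ℕ} (E : Edge d) : Set (Point d) := convexHull ℝ {x | x ∈ E}

/-- A triangle `conv {a, b, c}` with the reference edge `{a, b}`, the node `c` opposite to it, and
its level `gen`. (Non-degeneracy is part of the definition of a mesh.) -/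
structure Elem (d : ℕ) where
  a : Point d
  b : Point d
  c : Point d
  gen : ℕ

namespace Elem

variable {d : ℕ}

/-- The set of nodes of an element. -/
def nodes (T : Elem d) : Set (Point d) := {T.a, T.b, T.c}

/-- The (closed, filled) triangle as a set of points. -/
def carrier (T : Elem d) : Set (Point d) := convexHull ℝ T.nodes

/-- The reference edge `E_T`. -/
def refEdge (T : Elem d) : Edge d := s(T.a, T.b)

/-- The three edges of an element. -/
def edges (T : Elem d) : Set (Edge d) := {s(T.a, T.b), s(T.b, T.c), s(T.c, T.a)}

/-- The triangle is non-degenerate. -/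
def Nondegenerate (T : Elem d) : Prop := AffineIndependent ℝ ![T.a, T.b, T.c]

/-- The area `|T|`: two-dimensional Euclidean surface measure. -/
def area (T : Elem d) : ℝ := (μHE[2] T.carrier).toReal

/-- The diameter `diam(T)`. -/
def diam (T : Elem d) : ℝ := Metric.diam T.carrier

/-- The midpoint of the reference edge (the newest vertex of the two sons of `T`). -/
def mid (T : Elem d) : Point d := midpoint ℝ T.a T.b

/-- The son of `T` at the node `a`: its reference edge `{c, a}` is opposite to the newest vertex. -/
def son₁ (T : Elem d) : Elem d := ⟨T.c, T.a, T.mid, T.gen + 1⟩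

/-- The son of `T` at the node `b`: its reference edge `{b, c}` is opposite to the newest vertex. -/
def son₂ (T : Elem d) : Elem d := ⟨T.b, T.c, T.mid, T.gen + 1⟩

/-- Bisection of `T`. -/
def bisect (T : Elem d) : Set (Elem d) := {T.son₁, T.son₂}

open Classical in
/-- Bisect `T` if its reference edge is marked. -/
def bisectIf (M : Set (Edge d)) (T : Elem d) : Set (Elem d) :=
  if T.refEdge ∈ M then T.bisect else {T}

open Classical in
/-- The newest vertex bisection rule for a set `M` of marked edges which contains `E_T` if it
contains any edge of `T`: the reference edge is bisected if it is marked, and then each of the two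
sons is bisected if its reference edge (one of the other two edges of `T`) is marked. So `T` is kept
or is split into 2, 3 or 4 elements. -/
def nvbRefine (M : Set (Edge d)) (T : Elem d) : Set (Elem d) :=
  if T.refEdge ∈ M then T.son₁.bisectIf M ∪ T.son₂.bisectIf M else {T}

/-- Three bisections, into four elements. -/
def bisec3 (T : Elem d) : Set (Elem d) := T.son₁.bisect ∪ T.son₂.bisect

/-- Five bisections: after three bisections, also the two elements at the interior edge from `c` to
the midpoint of the reference edge, which is their common reference edge, are bisected. -/
def bisec5 (T : Elem d) : Set (Elem d) :=
  {T.son₁.son₂, T.son₂.son₁} ∪ T.son₁.son₁.bisect ∪ T.son₂.son₂.bisect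

/-- Red refinement into four elements similar to `T`, the reference edge of each of them being the
one parallel to the reference edge of `T`. -/
def red (T : Elem d) : Set (Elem d) :=
  {⟨T.a, midpoint ℝ T.a T.b, midpoint ℝ T.c T.a, T.gen + 2⟩,
   ⟨midpoint ℝ T.a T.b, T.b, midpoint ℝ T.b T.c, T.gen + 2⟩,
   ⟨midpoint ℝ T.c T.a, midpoint ℝ T.b T.c, T.c, T.gen + 2⟩,
   ⟨midpoint ℝ T.b T.c, midpoint ℝ T.c T.a, midpoint ℝ T.a T.b, T.gen + 2⟩}

end Elem

/-- The refinement patterns for elements all of whose edges are marked. -/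
inductive Pattern where
  | bisec3
  | red
  | bisec5

/-- The sons of `T` under a given pattern. -/
def Pattern.apply {d : ℕ} : Pattern → Elem d → Set (Elem d)
  | .bisec3, T => T.bisec3
  | .red, T => T.red
  | .bisec5, T => T.bisec5

section Mesh

variable {d : ℕ}

/-- `𝒯` is a mesh on `Ω`: a finite set of non-degenerate triangles, each with a reference edge, which
cover the closure of `Ω`, and any two of which are disjoint or meet in a common node or a common
edge. -/
structure IsMeshOn (Ω : Set (Point d)) (𝒯 : Set (Elem d)) : Prop where
  finite : 𝒯.Finite
  nondegenerate : ∀ T ∈ 𝒯, T.Nondegenerate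
  cover : closure Ω = ⋃ T ∈ 𝒯, T.carrier
  conforming : ∀ T₁ ∈ 𝒯, ∀ T₂ ∈ 𝒯, T₁ ≠ T₂ →
    T₁.carrier ∩ T₂.carrier = ∅ ∨
    (∃ x ∈ T₁.nodes ∩ T₂.nodes, T₁.carrier ∩ T₂.carrier = {x}) ∨
    (∃ E ∈ T₁.edges ∩ T₂.edges, T₁.carrier ∩ T₂.carrier = E.carrier)

/-- The set of edges of a mesh. -/
def meshEdges (𝒯 : Set (Elem d)) : Set (Edge d) := {E | ∃ T ∈ 𝒯, E ∈ T.edges}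

/-- `T₁, T₂ ∈ 𝒯` share the edge `E`, i.e. `T₁ ∩ T₂ = E`, where `E` is an edge of the mesh `𝒯`. -/
def SharesEdge (𝒯 : Set (Elem d)) (T₁ T₂ : Elem d) (E : Edge d) : Prop :=
  T₁ ∈ 𝒯 ∧ T₂ ∈ 𝒯 ∧ E ∈ meshEdges 𝒯 ∧ T₁.carrier ∩ T₂.carrier = E.carrier

/-- `T'` is the reference neighbour `N(T)` of `T` in `𝒯`: `T` shares its reference edge with `T'`. -/
def IsRefNeighbor (𝒯 : Set (Elem d)) (T T' : Elem d) : Prop := SharesEdge 𝒯 T T' T.refEdge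

/-- `T₁, T₂ ∈ 𝒯` are compatibly divisible: they share an edge, which is the reference edge of both or
of none of them. -/
def CompatiblyDivisible (𝒯 : Set (Elem d)) (T₁ T₂ : Elem d) : Prop :=
  ∃ E, SharesEdge 𝒯 T₁ T₂ E ∧
    ((T₁.refEdge = E ∧ T₂.refEdge = E) ∨ (T₁.refEdge ≠ E ∧ T₂.refEdge ≠ E))

/-- `T` is a successor of `T'` (and `T'` an ancestor of `T`): it is obtained from `T'` by finitely
many (possibly zero) bisections. -/
def IsSuccessor (T' T : Elem d) : Prop := Relation.ReflTransGen (fun S S' => S' ∈ S.bisect) T' T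

/-- Sets of marked edges `M⁽ᵏ⁾` in the mesh closure of newest vertex bisection. -/
def nvbMarks (𝒯 : Set (Elem d)) (M₀ : Set (Edge d)) : ℕ → Set (Edge d)
  | 0 => M₀
  | k + 1 => {E | ∃ T ∈ 𝒯, (∃ E' ∈ nvbMarks 𝒯 M₀ k, E' ∈ T.edges) ∧ E = T.refEdge}

/-- Sets of marked edges `M⁽ᵏ⁾` in the mesh closure of modified newest vertex bisection. -/
def mnvbMarks (𝒯 : Set (Elem d)) (M₀ : Set (Edge d)) : ℕ → Set (Edge d)
  | 0 => M₀
  | k + 1 => mnvbMarks 𝒯 M₀ k ∪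
      {E | ∃ T ∈ 𝒯, (∃ E' ∈ mnvbMarks 𝒯 M₀ k, E' ∈ T.edges) ∧ E = T.refEdge}

/-- The loop "while `M⁽ᵏ⁾ ⊊ M⁽ᵏ⁺¹⁾` increase `k`", started at `k = 0`, stops with the set `M`. -/
def StopsWith (marks : ℕ → Set (Edge d)) (M : Set (Edge d)) : Prop :=
  ∃ k, (∀ j < k, marks j ⊂ marks (j + 1)) ∧ ¬ marks k ⊂ marks (k + 1) ∧ M = marks k

/-- `𝒯' = refineNVB(𝒯, ℳ)` for some set `ℳ ⊆ 𝒯` of marked elements: one call of newest vertex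
bisection, which marks the reference edges of the elements of `ℳ`, computes the mesh closure, and
refines each element. -/
def NVBStep (𝒯 𝒯' : Set (Elem d)) : Prop :=
  ∃ ℳ ⊆ 𝒯, ∃ M, StopsWith (nvbMarks 𝒯 (Elem.refEdge '' ℳ)) M ∧ 𝒯' = ⋃ T ∈ 𝒯, T.nvbRefine M

open Classical in
/-- Modified rule: elements all of whose edges are marked are refined by the pattern `p`, all other
ones by newest vertex bisection. -/
def Elem.mnvbRefine (M : Set (Edge d)) (p : Pattern) (T : Elem d) : Set (Elem d) :=
  if T.edges ⊆ M then p.apply T else T.nvbRefine M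

/-- `𝒯' = refine(𝒯, ℳ)` for some set `ℳ ⊆ 𝒯` of marked elements: one call of modified newest vertex
bisection, which marks some edges `M₀` of the elements of `ℳ`, computes the mesh closure, and refines
each element, where the pattern for elements with three marked edges is chosen element by element. -/
def MNVBStep (𝒯 𝒯' : Set (Elem d)) : Prop :=
  ∃ ℳ ⊆ 𝒯, ∃ M₀ ⊆ {E : Edge d | ∃ T ∈ ℳ, E ∈ T.edges}, ∃ M, StopsWith (mnvbMarks 𝒯 M₀) M ∧
    ∃ p : Elem d → Pattern, 𝒯' = ⋃ T ∈ 𝒯, T.mnvbRefine M (p T)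

/-- `𝒯' = refineNVB(𝒯)`: finitely many calls of newest vertex bisection. -/
def RefineNVB (𝒯 𝒯' : Set (Elem d)) : Prop := Relation.ReflTransGen NVBStep 𝒯 𝒯'

/-- `𝒯' = refine(𝒯)`: finitely many calls of modified newest vertex bisection. -/
def RefineMNVB (𝒯 𝒯' : Set (Elem d)) : Prop := Relation.ReflTransGen MNVBStep 𝒯 𝒯'

end Mesh

end NVB

end

open NVB

/-! ### Barycentric coordinates as weights on points -/

namespace NVB

open Finsupp

variable {d : ℕ}

namespace Elem

/-! Levels can be read off from lengths. An affine change of metric makes an initial element an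
isosceles right triangle with its reference edge as hypotenuse (`exists_isRightIsosceles`).
Bisection and red refinement reproduce this shape, so in every descendant an edge has squared length
`4 * (1 / 2) ^ l`, where `l = edgeLevel` is `gen` for the reference edge and `gen + 1` for the other
two (`planeForm_edge`). Hence two descendants of one initial element assign the same level to a
common edge. If the ancestors differ, the edge lies on a common edge of theirs, both metrics scale
along that edge by the same factor, and the two levels differ exactly as the levels of the initial
edge do, by at most one (`exists_edge_of_ancestor_ne`). The claims on levels of neighbours and on
compatible divisibility are then arithmetic.

In a chain of equal level, a reference edge that differs from the next one lies on an initial edge.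
An element with two edges on initial edges fills a corner of an initial triangle, and each corner
belongs to at most one element of the mesh. So a chain has boundedly many different reference edges,
and each of them belongs to boundedly many elements (`exists_chain_bound`).

The size bounds come from two exact scaling laws: bisection halves `sizeSq`, by the parallelogram
law, and divides the Gram determinant by four.

All of this needs conformity of the refined mesh. It is carried along in the form that barycentric
coordinates, seen as weights on points of space, depend on the point and not on the element
(`IsConforming`). A refinement acts on the weights along an edge by a rule which knows only whether
that edge is marked (`IsSubdiv`, `seg`), so this property survives (`IsConforming.refine`). -/

theorem nondegenerate_iff (T : Elem d) : T.Nondegenerate ↔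
    ∀ s t : ℝ, s • (T.b - T.a) + t • (T.c - T.a) = 0 → s = 0 ∧ t = 0 := by
  rw [Nondegenerate, affineIndependent_iff_linearIndependent_vsub ℝ _ (0 : Fin 3)]
  rw [← LinearIndependent.pair_iff,
    ← linearIndependent_equiv (finSuccAboveEquiv (0 : Fin 3))]
  congr! 1
  ext i : 1
  fin_cases i <;> simp [finSuccAboveEquiv]

/-- The weight function with weights `s`, `t`, `r` at the nodes `a`, `b`, `c`. -/
noncomputable def bary (T : Elem d) (s t r : ℝ) : Point d →₀ ℝ :=
  single T.a s + single T.b t + single T.c r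

/-- `μ` is the family of barycentric coordinates of a point of `T`. -/
def IsBary (T : Elem d) (μ : Point d →₀ ℝ) : Prop :=
  ∃ s t r : ℝ, 0 ≤ s ∧ 0 ≤ t ∧ 0 ≤ r ∧ s + t + r = 1 ∧ μ = T.bary s t r

/-- `μ` is positive at all nodes of `T`. -/
def IsPos (T : Elem d) (μ : Point d →₀ ℝ) : Prop := 0 < μ T.a ∧ 0 < μ T.b ∧ 0 < μ T.c

end Elem

/-- The point with the given weights. -/
noncomputable def toPoint : (Point d →₀ ℝ) →ₗ[ℝ] Point d := Finsupp.linearCombination ℝ id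

@[simp] theorem toPoint_single (x : Point d) (s : ℝ) : toPoint (single x s) = s • x := by
  simp [toPoint]

namespace Elem

variable {T : Elem d}

theorem toPoint_bary (T : Elem d) (s t r : ℝ) :
    toPoint (T.bary s t r) = s • T.a + t • T.b + r • T.c := by
  simp [bary]

theorem mem_carrier_iff {T : Elem d} {x : Point d} :
    x ∈ T.carrier ↔ ∃ μ, T.IsBary μ ∧ toPoint μ = x := by
  rw [carrier, nodes, convexHull_insert (by simp), convexHull_pair]
  simp only [segment_eq_image, convexJoin, Set.mem_iUnion, Set.mem_image, Set.mem_singleton_iff,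
    exists_prop, exists_eq_left]
  constructor
  · rintro ⟨y, ⟨t, ⟨ht0, ht1⟩, rfl⟩, s, ⟨hs0, hs1⟩, rfl⟩
    refine ⟨T.bary (1 - s) (s * (1 - t)) (s * t), ⟨_, _, _, by linarith, ?_, ?_, ?_, rfl⟩, ?_⟩
    · exact mul_nonneg hs0 (by linarith)
    · exact mul_nonneg hs0 ht0
    · ring
    · rw [toPoint_bary]; module
  · rintro ⟨_, ⟨s, t, r, hs, ht, hr, h1, rfl⟩, rfl⟩
    rw [toPoint_bary]
    -- The hull is the join of `T.a` with the opposite edge; the foot on that edge comes from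
    -- division by `t + r`. If `t + r = 0` the point is `T.a` and any foot will do.
    rcases eq_or_lt_of_le (add_nonneg ht hr) with h0 | h0
    · have ht0 : t = 0 := by linarith
      have hr0 : r = 0 := by linarith
      have hs1 : s = 1 := by linarith
      subst ht0 hr0 hs1
      exact ⟨T.b, ⟨0, by simp, by simp⟩, 0, by simp, by simp⟩
    · refine ⟨_, ⟨r / (t + r), ⟨by positivity, ?_⟩, rfl⟩, t + r, ⟨h0.le, by linarith⟩, ?_⟩
      · rw [div_le_one h0]; linarith
      · have : s = 1 - (t + r) := by linarith
        subst this
        have e : 1 - r / (t + r) = t / (t + r) := by field_simp; ring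
        rw [e, smul_add, smul_smul, smul_smul, mul_div_cancel₀ _ h0.ne', mul_div_cancel₀ _ h0.ne',
          add_assoc]

theorem Nondegenerate.coord_unique (h : T.Nondegenerate) {s t r s' t' r' : ℝ}
    (h1 : s + t + r = s' + t' + r')
    (h2 : s • T.a + t • T.b + r • T.c = s' • T.a + t' • T.b + r' • T.c) :
    s = s' ∧ t = t' ∧ r = r' := by
  have h3 : (t - t') • (T.b - T.a) + (r - r') • (T.c - T.a) = 0 := by
    have e : s = s' + t' + r' - t - r := by linarith
    subst e
    rw [← sub_eq_zero] at h2
    rw [← h2]; module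
  obtain ⟨h4, h5⟩ := (nondegenerate_iff T).1 h _ _ h3
  refine ⟨?_, ?_, ?_⟩ <;> linarith

theorem Nondegenerate.bary_unique (h : T.Nondegenerate) {μ ν : Point d →₀ ℝ}
    (hμ : T.IsBary μ) (hν : T.IsBary ν) (e : toPoint μ = toPoint ν) : μ = ν := by
  obtain ⟨s, t, r, -, -, -, h1, rfl⟩ := hμ
  obtain ⟨s', t', r', -, -, -, h1', rfl⟩ := hν
  rw [toPoint_bary, toPoint_bary] at e
  obtain ⟨rfl, rfl, rfl⟩ := h.coord_unique (by linarith) e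
  rfl

theorem Nondegenerate.ab (h : T.Nondegenerate) : T.a ≠ T.b := by
  intro e
  have := h.coord_unique (s := 1) (t := 0) (r := 0) (s' := 0) (t' := 1) (r' := 0) (by norm_num)
    (by simp [e])
  simp at this

theorem Nondegenerate.bc (h : T.Nondegenerate) : T.b ≠ T.c := by
  intro e
  have := h.coord_unique (s := 0) (t := 1) (r := 0) (s' := 0) (t' := 0) (r' := 1) (by norm_num)
    (by simp [e])
  simp at this

theorem Nondegenerate.ca (h : T.Nondegenerate) : T.c ≠ T.a := by
  intro e
  have := h.coord_unique (s := 1) (t := 0) (r := 0) (s' := 0) (t' := 0) (r' := 1) (by norm_num)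
    (by simp [e])
  simp at this

theorem bary_apply_a (h : T.Nondegenerate) (s t r : ℝ) : T.bary s t r T.a = s := by
  simp [bary, h.ab.symm, h.ca]

theorem bary_apply_b (h : T.Nondegenerate) (s t r : ℝ) : T.bary s t r T.b = t := by
  simp [bary, h.ab, h.bc.symm]

theorem bary_apply_c (h : T.Nondegenerate) (s t r : ℝ) : T.bary s t r T.c = r := by
  simp [bary, h.bc, h.ca.symm]

theorem isPos_bary (h : T.Nondegenerate) {s t r : ℝ} :
    T.IsPos (T.bary s t r) ↔ 0 < s ∧ 0 < t ∧ 0 < r := by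
  rw [IsPos, bary_apply_a h, bary_apply_b h, bary_apply_c h]

theorem mid_eq (T : Elem d) : T.mid = (2⁻¹ : ℝ) • T.a + (2⁻¹ : ℝ) • T.b := by
  rw [mid, midpoint_eq_smul_add, smul_add]; norm_num

theorem Nondegenerate.son₁ (h : T.Nondegenerate) : T.son₁.Nondegenerate := by
  rw [nondegenerate_iff] at h ⊢
  intro s t e
  have := h (t / 2) (- s - t) (by rw [← e]; simp only [Elem.son₁, mid_eq]; module)
  constructor <;> linarith [this.1, this.2]

theorem Nondegenerate.son₂ (h : T.Nondegenerate) : T.son₂.Nondegenerate := by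
  rw [nondegenerate_iff] at h ⊢
  intro s t e
  have := h (- s - t / 2) s (by rw [← e]; simp only [Elem.son₂, mid_eq]; module)
  constructor <;> linarith [this.1, this.2]

theorem Nondegenerate.mem_red (h : T.Nondegenerate) {S : Elem d} (hS : S ∈ T.red) :
    S.Nondegenerate := by
  rw [nondegenerate_iff] at h ⊢
  intro s t e
  rcases hS with rfl | rfl | rfl | rfl <;> simp only [midpoint_eq_smul_add] at e
  · have := h (s / 2) (t / 2) (by rw [← e]; norm_num; module)
    constructor <;> linarith [this.1, this.2]
  · have := h (s / 2) (t / 2) (by rw [← e]; norm_num; module)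
    constructor <;> linarith [this.1, this.2]
  · have := h (s / 2) (t / 2) (by rw [← e]; norm_num; module)
    constructor <;> linarith [this.1, this.2]
  · have := h (- s / 2) (- t / 2) (by rw [← e]; norm_num; module)
    constructor <;> linarith [this.1, this.2]

theorem son₁_carrier_subset (T : Elem d) : T.son₁.carrier ⊆ T.carrier := by
  intro x hx
  rw [mem_carrier_iff] at hx ⊢
  obtain ⟨_, ⟨s, t, r, hs, ht, hr, h1, rfl⟩, rfl⟩ := hx
  refine ⟨_, ⟨t + r / 2, r / 2, s, by positivity, by positivity, hs, by linarith, rfl⟩, ?_⟩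
  simp only [toPoint_bary, son₁, mid_eq]; module

theorem son₂_carrier_subset (T : Elem d) : T.son₂.carrier ⊆ T.carrier := by
  intro x hx
  rw [mem_carrier_iff] at hx ⊢
  obtain ⟨_, ⟨s, t, r, hs, ht, hr, h1, rfl⟩, rfl⟩ := hx
  refine ⟨_, ⟨r / 2, s + r / 2, t, by positivity, by positivity, ht, by linarith, rfl⟩, ?_⟩
  simp only [toPoint_bary, son₂, mid_eq]; module

theorem midpoint_mem_carrier {x y : Point d} (hx : x ∈ T.carrier) (hy : y ∈ T.carrier) :
    midpoint ℝ x y ∈ T.carrier :=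
  (convex_convexHull ℝ _).midpoint_mem hx hy

theorem a_mem_carrier (T : Elem d) : T.a ∈ T.carrier :=
  subset_convexHull ℝ _ (by simp [nodes])

theorem b_mem_carrier (T : Elem d) : T.b ∈ T.carrier :=
  subset_convexHull ℝ _ (by simp [nodes])

theorem c_mem_carrier (T : Elem d) : T.c ∈ T.carrier :=
  subset_convexHull ℝ _ (by simp [nodes])

theorem carrier_subset_of_mem_red {S : Elem d} (hS : S ∈ T.red) : S.carrier ⊆ T.carrier := by
  have ha := T.a_mem_carrier
  have hb := T.b_mem_carrier
  have hc := T.c_mem_carrier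
  have hm := midpoint_mem_carrier ha hb
  have hn := midpoint_mem_carrier hc ha
  have hl := midpoint_mem_carrier hb hc
  refine convexHull_min ?_ (convex_convexHull ℝ _)
  rcases hS with rfl | rfl | rfl | rfl <;>
    simp only [nodes, Set.insert_subset_iff, Set.singleton_subset_iff] <;>
    exact ⟨by assumption, by assumption, by assumption⟩

end Elem

end NVB

/-! ### Subdivisions of a triangle in barycentric coordinates; bisection -/

namespace NVB

open Finsupp

variable {d : ℕ}

open Classical in
/-- The weights of the point `ξ u + η v` of the edge `{u, v}` with respect to the refined edge: it
is halved if it is marked. -/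
noncomputable def seg (M : Set (Edge d)) (u v : Point d) (ξ η : ℝ) : Point d →₀ ℝ :=
  if s(u, v) ∈ M then
    single u (ξ - min ξ η) + single v (η - min ξ η) + single (midpoint ℝ u v) (2 * min ξ η)
  else single u ξ + single v η

theorem seg_comm (M : Set (Edge d)) (u v : Point d) (ξ η : ℝ) :
    seg M u v ξ η = seg M v u η ξ := by
  unfold seg
  rw [Sym2.eq_swap, min_comm, midpoint_comm, add_comm (single u ξ),
    add_comm (single u (ξ - min η ξ))]

theorem seg_zero_right (M : Set (Edge d)) (u v : Point d) {ξ : ℝ} (h : 0 ≤ ξ) :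
    seg M u v ξ 0 = single u ξ := by
  unfold seg
  rw [min_eq_right h]
  split_ifs <;> simp

theorem seg_zero_left (M : Set (Edge d)) (u v : Point d) {η : ℝ} (h : 0 ≤ η) :
    seg M u v 0 η = single v η := by
  rw [seg_comm, seg_zero_right M _ _ h]

theorem seg_of_notMem {M : Set (Edge d)} {u v : Point d} (h : s(u, v) ∉ M) (ξ η : ℝ) :
    seg M u v ξ η = single u ξ + single v η := if_neg h

theorem seg_of_mem_of_le {M : Set (Edge d)} {u v : Point d} (h : s(u, v) ∈ M) {ξ η : ℝ}
    (hle : η ≤ ξ) : seg M u v ξ η = single u (ξ - η) + single (midpoint ℝ u v) (2 * η) := by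
  unfold seg
  rw [if_pos h, min_eq_right hle]
  simp

theorem seg_congr {M M' : Set (Edge d)} {u v : Point d} (h : s(u, v) ∈ M ↔ s(u, v) ∈ M')
    (ξ η : ℝ) : seg M u v ξ η = seg M' u v ξ η := by
  unfold seg
  by_cases hM : s(u, v) ∈ M
  · rw [if_pos hM, if_pos (h.1 hM)]
  · rw [if_neg hM, if_neg (mt h.2 hM)]

/-- `R` is a conforming subdivision of `T` which halves the edges of `T` in `M` and keeps the other
ones, where `Φ` turns the barycentric coordinates in `T` into those in the members of `R`. -/
structure IsSubdiv (M : Set (Edge d)) (T : Elem d) (R : Set (Elem d))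
    (Φ : (Point d →₀ ℝ) → (Point d →₀ ℝ)) : Prop where
  lift : ∀ S ∈ R, ∀ μ, S.IsBary μ →
    ∃ w, T.IsBary w ∧ toPoint w = toPoint μ ∧ Φ w = μ ∧ (S.IsPos μ → T.IsPos w)
  edge : ∀ u v, s(u, v) ∈ T.edges → ∀ ξ η : ℝ, 0 ≤ ξ → 0 ≤ η → ξ + η = 1 →
    Φ (single u ξ + single v η) = seg M u v ξ η
  unique : ∀ S ∈ R, ∀ S' ∈ R, ∀ μ, S.IsPos μ → S.IsBary μ → S'.IsBary μ → S = S'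

/-- Since `seg` is symmetric, one orientation of each of the three edges is enough. -/
theorem IsSubdiv.mk' {M : Set (Edge d)} {T : Elem d} {R : Set (Elem d)}
    {Φ : (Point d →₀ ℝ) → (Point d →₀ ℝ)}
    (lift : ∀ S ∈ R, ∀ μ, S.IsBary μ →
      ∃ w, T.IsBary w ∧ toPoint w = toPoint μ ∧ Φ w = μ ∧ (S.IsPos μ → T.IsPos w))
    (hab : ∀ ξ η : ℝ, 0 ≤ ξ → 0 ≤ η → ξ + η = 1 → Φ (T.bary ξ η 0) = seg M T.a T.b ξ η)
    (hbc : ∀ ξ η : ℝ, 0 ≤ ξ → 0 ≤ η → ξ + η = 1 → Φ (T.bary 0 ξ η) = seg M T.b T.c ξ η)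
    (hca : ∀ ξ η : ℝ, 0 ≤ ξ → 0 ≤ η → ξ + η = 1 → Φ (T.bary η 0 ξ) = seg M T.c T.a ξ η)
    (unique : ∀ S ∈ R, ∀ S' ∈ R, ∀ μ, S.IsPos μ → S.IsBary μ → S'.IsBary μ → S = S') :
    IsSubdiv M T R Φ where
  lift := lift
  unique := unique
  edge := by
    have hab' : ∀ ξ η : ℝ, 0 ≤ ξ → 0 ≤ η → ξ + η = 1 →
        Φ (single T.a ξ + single T.b η) = seg M T.a T.b ξ η := by
      intro ξ η h1 h2 h3
      rw [← hab ξ η h1 h2 h3]; simp [Elem.bary]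
    have hbc' : ∀ ξ η : ℝ, 0 ≤ ξ → 0 ≤ η → ξ + η = 1 →
        Φ (single T.b ξ + single T.c η) = seg M T.b T.c ξ η := by
      intro ξ η h1 h2 h3
      rw [← hbc ξ η h1 h2 h3]; simp [Elem.bary]
    have hca' : ∀ ξ η : ℝ, 0 ≤ ξ → 0 ≤ η → ξ + η = 1 →
        Φ (single T.c ξ + single T.a η) = seg M T.c T.a ξ η := by
      intro ξ η h1 h2 h3
      rw [← hca ξ η h1 h2 h3]; simp [Elem.bary, add_comm]
    intro u v huv ξ η h1 h2 h3
    have h3' : η + ξ = 1 := by linarith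
    simp only [Elem.edges, Set.mem_insert_iff, Set.mem_singleton_iff, Sym2.eq_iff] at huv
    rcases huv with (⟨rfl, rfl⟩ | ⟨rfl, rfl⟩) | (⟨rfl, rfl⟩ | ⟨rfl, rfl⟩) |
      (⟨rfl, rfl⟩ | ⟨rfl, rfl⟩)
    · exact hab' _ _ h1 h2 h3
    · rw [add_comm, seg_comm]; exact hab' _ _ h2 h1 h3'
    · exact hbc' _ _ h1 h2 h3
    · rw [add_comm, seg_comm]; exact hbc' _ _ h2 h1 h3'
    · exact hca' _ _ h1 h2 h3
    · rw [add_comm, seg_comm]; exact hca' _ _ h2 h1 h3'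

theorem isSubdiv_singleton {M : Set (Edge d)} {T : Elem d} (hab : s(T.a, T.b) ∉ M)
    (hbc : s(T.b, T.c) ∉ M) (hca : s(T.c, T.a) ∉ M) : IsSubdiv M T {T} id := by
  refine IsSubdiv.mk' ?_ ?_ ?_ ?_ ?_
  · rintro S rfl μ hμ
    exact ⟨μ, hμ, rfl, rfl, id⟩
  · intro ξ η _ _ _
    rw [seg_of_notMem hab]; simp [Elem.bary]
  · intro ξ η _ _ _
    rw [seg_of_notMem hbc]; simp [Elem.bary]
  · intro ξ η _ _ _
    rw [seg_of_notMem hca]; simp [Elem.bary, add_comm]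
  · rintro S rfl S' rfl _ _ _ _; rfl

open Classical in
/-- The change of barycentric coordinates under a bisection which is followed by subdivisions of the
two sons. -/
noncomputable def bisectMap (T : Elem d) (Φ₁ Φ₂ : (Point d →₀ ℝ) → (Point d →₀ ℝ))
    (w : Point d →₀ ℝ) : Point d →₀ ℝ :=
  if w T.b ≤ w T.a then Φ₁ (T.son₁.bary (w T.c) (w T.a - w T.b) (2 * w T.b))
  else Φ₂ (T.son₂.bary (w T.b - w T.a) (w T.c) (2 * w T.a))

theorem bisectMap_of_le {T : Elem d} (h : T.Nondegenerate)
    (Φ₁ Φ₂ : (Point d →₀ ℝ) → (Point d →₀ ℝ)) {α β γ : ℝ} (hle : β ≤ α) :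
    bisectMap T Φ₁ Φ₂ (T.bary α β γ) = Φ₁ (T.son₁.bary γ (α - β) (2 * β)) := by
  rw [bisectMap, Elem.bary_apply_a h, Elem.bary_apply_b h, Elem.bary_apply_c h, if_pos hle]

theorem bisectMap_of_lt {T : Elem d} (h : T.Nondegenerate)
    (Φ₁ Φ₂ : (Point d →₀ ℝ) → (Point d →₀ ℝ)) {α β γ : ℝ} (hlt : α < β) :
    bisectMap T Φ₁ Φ₂ (T.bary α β γ) = Φ₂ (T.son₂.bary (β - α) γ (2 * α)) := by
  rw [bisectMap, Elem.bary_apply_a h, Elem.bary_apply_b h, Elem.bary_apply_c h,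
    if_neg (not_le.2 hlt)]

/-- The set `M'` records which edges of the sons are halved later on: it agrees with `M` on the two
edges inherited from `T` and contains neither half of the reference edge. The edge between the sons
may or may not be in `M'`; on it both `Φ₁` and `Φ₂` are given by `seg M'`, so the two maps glue to
one. -/
theorem isSubdiv_bisect {M M' : Set (Edge d)} {T : Elem d} (h : T.Nondegenerate)
    {R₁ R₂ : Set (Elem d)} {Φ₁ Φ₂ : (Point d →₀ ℝ) → (Point d →₀ ℝ)}
    (hab : s(T.a, T.b) ∈ M) (hbc : s(T.b, T.c) ∈ M ↔ s(T.b, T.c) ∈ M')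
    (hca : s(T.c, T.a) ∈ M ↔ s(T.c, T.a) ∈ M') (ham : s(T.a, T.mid) ∉ M')
    (hmb : s(T.mid, T.b) ∉ M')
    (h₁ : IsSubdiv M' T.son₁ R₁ Φ₁) (h₂ : IsSubdiv M' T.son₂ R₂ Φ₂) :
    IsSubdiv M T (R₁ ∪ R₂) (bisectMap T Φ₁ Φ₂) := by
  have key₁ : ∀ s t r : ℝ, toPoint (T.son₁.bary s t r) = toPoint (T.bary (t + r / 2) (r / 2) s) := by
    intro s t r
    simp only [Elem.toPoint_bary, Elem.son₁, Elem.mid_eq]; module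
  have key₂ : ∀ s t r : ℝ, toPoint (T.son₂.bary s t r) = toPoint (T.bary (r / 2) (s + r / 2) t) := by
    intro s t r
    simp only [Elem.toPoint_bary, Elem.son₂, Elem.mid_eq]; module
  have disj : ∀ S ∈ R₁, ∀ S' ∈ R₂, ∀ μ, (S.IsPos μ ∨ S'.IsPos μ) → S.IsBary μ → S'.IsBary μ →
      False := by
    intro S hS S' hS' μ hpos hμ hμ'
    obtain ⟨_, ⟨s, t, r, hs, ht, hr, hsum, rfl⟩, e₁, -, pos₁⟩ := h₁.lift S hS μ hμ
    obtain ⟨_, ⟨s', t', r', hs', ht', hr', hsum', rfl⟩, e₂, -, pos₂⟩ := h₂.lift S' hS' μ hμ'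
    rw [← e₂, key₁, key₂, Elem.toPoint_bary, Elem.toPoint_bary] at e₁
    -- In the coordinates of `T` the first son has `α ≥ β` and the second one `α ≤ β`; equality of
    -- the points forces `t + s' = 0`, which positivity excludes.
    obtain ⟨i1, i2, i3⟩ := h.coord_unique (by linarith) e₁
    rcases hpos with hpos | hpos
    · have := (Elem.isPos_bary h.son₁).1 (pos₁ hpos)
      linarith [this.2.1]
    · have := (Elem.isPos_bary h.son₂).1 (pos₂ hpos)
      linarith [this.1]
  refine IsSubdiv.mk' ?_ ?_ ?_ ?_ ?_
  · rintro S (hS | hS) μ hμ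
    · obtain ⟨_, ⟨s, t, r, hs, ht, hr, hsum, rfl⟩, e, rfl, pos⟩ := h₁.lift S hS μ hμ
      refine ⟨T.bary (t + r / 2) (r / 2) s,
        ⟨_, _, _, by positivity, by positivity, hs, by linarith, rfl⟩, by rw [← e, key₁], ?_, ?_⟩
      · rw [bisectMap_of_le h _ _ (by linarith)]
        congr 2 <;> ring
      · intro hp
        have := (Elem.isPos_bary h.son₁).1 (pos hp)
        rw [Elem.isPos_bary h]
        refine ⟨?_, ?_, ?_⟩ <;> linarith
    · obtain ⟨_, ⟨s, t, r, hs, ht, hr, hsum, rfl⟩, e, rfl, pos⟩ := h₂.lift S hS μ hμ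
      refine ⟨T.bary (r / 2) (s + r / 2) t,
        ⟨_, _, _, by positivity, by positivity, ht, by linarith, rfl⟩, by rw [← e, key₂], ?_, ?_⟩
      -- For `s = 0` the point is on the edge between the sons, where `bisectMap` takes the branch
      -- of the first son.
      · rcases eq_or_lt_of_le hs with rfl | hs
        · rw [bisectMap_of_le h _ _ (by linarith)]
          have e1 := h₁.edge T.mid T.c (by simp [Elem.edges, Elem.son₁]) r t hr ht (by linarith)
          have e2 := h₂.edge T.mid T.c (by simp [Elem.edges, Elem.son₂]) r t hr ht (by linarith)
          rw [← e1] at e2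
          convert e2.symm using 2
          · simp only [Elem.bary, Elem.son₁, zero_add, sub_self, single_zero, add_zero]
            rw [add_comm]; congr 2; ring
          · simp only [Elem.bary, Elem.son₂, single_zero, zero_add]
            rw [add_comm]
        · rw [bisectMap_of_lt h _ _ (by linarith)]
          congr 2 <;> ring
      · intro hp
        have := (Elem.isPos_bary h.son₂).1 (pos hp)
        rw [Elem.isPos_bary h]
        refine ⟨?_, ?_, ?_⟩ <;> linarith
  · intro ξ η hξ hη hsum
    rcases le_or_gt η ξ with hle | hlt
    · rw [bisectMap_of_le h _ _ hle, seg_of_mem_of_le hab hle, ← Elem.mid, ← seg_of_notMem ham,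
        ← h₁.edge T.a T.mid (by simp [Elem.edges, Elem.son₁]) _ _ (by linarith) (by linarith)
          (by linarith)]
      simp [Elem.bary, Elem.son₁]
    · rw [bisectMap_of_lt h _ _ hlt, seg_comm, seg_of_mem_of_le (by rwa [Sym2.eq_swap]) hlt.le,
        midpoint_comm, ← Elem.mid, ← seg_of_notMem (by rwa [Sym2.eq_swap]),
        ← h₂.edge T.b T.mid (by simp [Elem.edges, Elem.son₂]) _ _ (by linarith)
          (by linarith) (by linarith)]
      simp [Elem.bary, Elem.son₂]
  · intro ξ η hξ hη hsum
    -- The node `T.c` is the only point of this edge that falls into the branch of the first son.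
    rcases eq_or_lt_of_le hξ with rfl | hξ
    · rw [bisectMap_of_le h _ _ le_rfl, seg_zero_left M _ _ hη, ← seg_zero_right M' T.c T.a hη,
        ← h₁.edge T.c T.a (by simp [Elem.edges, Elem.son₁]) η 0 hη le_rfl (by linarith)]
      simp [Elem.bary, Elem.son₁]
    · rw [bisectMap_of_lt h _ _ hξ, seg_congr hbc,
        ← h₂.edge T.b T.c (by simp [Elem.edges, Elem.son₂]) ξ η hξ.le hη (by linarith)]
      simp [Elem.bary, Elem.son₂]
  · intro ξ η hξ hη hsum
    rw [bisectMap_of_le h _ _ hη, seg_congr hca,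
      ← h₁.edge T.c T.a (by simp [Elem.edges, Elem.son₁]) ξ η hξ hη hsum]
    simp [Elem.bary, Elem.son₁]
  · rintro S (hS | hS) S' (hS' | hS') μ hp hμ hμ'
    · exact h₁.unique S hS S' hS' μ hp hμ hμ'
    · exact (disj S hS S' hS' μ (.inl hp) hμ hμ').elim
    · exact (disj S' hS' S hS μ (.inr hp) hμ' hμ).elim
    · exact h₂.unique S hS S' hS' μ hp hμ hμ'

end NVB

/-! ### The refinement patterns are subdivisions -/

namespace NVB

open Finsupp

variable {d : ℕ}

theorem exists_isSubdiv_bisectIf {M : Set (Edge d)} {T : Elem d} (h : T.Nondegenerate)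
    (hbc : s(T.b, T.c) ∉ M) (hca : s(T.c, T.a) ∉ M) : ∃ Φ, IsSubdiv M T (T.bisectIf M) Φ := by
  unfold Elem.bisectIf
  split_ifs with hab
  · exact ⟨_, isSubdiv_bisect (M' := ∅) h hab (by simp [hbc]) (by simp [hca]) (by simp) (by simp)
      (isSubdiv_singleton (by simp) (by simp) (by simp))
      (isSubdiv_singleton (by simp) (by simp) (by simp))⟩
  · exact ⟨_, isSubdiv_singleton hab hbc hca⟩

namespace Elem

variable {T : Elem d}

theorem Nondegenerate.mid_ne_a (h : T.Nondegenerate) : T.mid ≠ T.a := h.son₁.bc.symm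

theorem Nondegenerate.mid_ne_b (h : T.Nondegenerate) : T.mid ≠ T.b := h.son₂.ca

theorem Nondegenerate.mid_ne_c (h : T.Nondegenerate) : T.mid ≠ T.c := h.son₁.ca

theorem bisectIf_congr {M M' : Set (Edge d)} (h : T.refEdge ∈ M ↔ T.refEdge ∈ M') :
    T.bisectIf M = T.bisectIf M' := by
  unfold bisectIf
  by_cases hM : T.refEdge ∈ M
  · rw [if_pos hM, if_pos (h.1 hM)]
  · rw [if_neg hM, if_neg (mt h.2 hM)]

theorem bisec5_eq (T : Elem d) : T.bisec5 =
    (T.son₁.son₁.bisect ∪ {T.son₁.son₂}) ∪ ({T.son₂.son₁} ∪ T.son₂.son₂.bisect) := by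
  ext S
  simp only [bisec5, Set.mem_union, Set.mem_insert_iff, Set.mem_singleton_iff]
  tauto

end Elem

open Elem

theorem exists_isSubdiv_nvbRefine {M : Set (Edge d)} {T : Elem d} (h : T.Nondegenerate)
    (hM : ∀ E ∈ T.edges, E ∈ M → T.refEdge ∈ M) : ∃ Φ, IsSubdiv M T (T.nvbRefine M) Φ := by
  have ma := h.mid_ne_a
  have mb := h.mid_ne_b
  have mc := h.mid_ne_c
  unfold Elem.nvbRefine
  split_ifs with hab
  -- `M` is an arbitrary set of point pairs and might contain a half of the reference edge or the
  -- edge between the sons; the intersection drops such pairs without changing the refinement of the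
  -- sons.
  · set M' : Set (Edge d) := M ∩ {s(T.b, T.c), s(T.c, T.a)} with hM'
    have e₁ : T.son₁.bisectIf M = T.son₁.bisectIf M' :=
      bisectIf_congr (by simp [hM', refEdge, Elem.son₁])
    have e₂ : T.son₂.bisectIf M = T.son₂.bisectIf M' :=
      bisectIf_congr (by simp [hM', refEdge, Elem.son₂])
    obtain ⟨Φ₁, h₁⟩ := exists_isSubdiv_bisectIf (M := M') h.son₁
      (by simp [hM', Elem.son₁, ma, mb, mc]) (by simp [hM', Elem.son₁, ma, mb, mc])
    obtain ⟨Φ₂, h₂⟩ := exists_isSubdiv_bisectIf (M := M') h.son₂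
      (by simp [hM', Elem.son₂, ma, mb, mc]) (by simp [hM', Elem.son₂, ma, mb, mc])
    rw [e₁, e₂]
    exact ⟨_, isSubdiv_bisect h hab (by simp [hM']) (by simp [hM'])
      (by simp [hM', ma, mb, mc]) (by simp [hM', ma, mb, mc]) h₁ h₂⟩
  · exact ⟨_, isSubdiv_singleton hab (fun h' => hab (hM _ (by simp [edges]) h'))
      (fun h' => hab (hM _ (by simp [edges]) h'))⟩

set_option linter.unusedSimpArgs false in
theorem exists_isSubdiv_bisec5 {M : Set (Edge d)} {T : Elem d} (h : T.Nondegenerate)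
    (hM : T.edges ⊆ M) : ∃ Φ, IsSubdiv M T T.bisec5 Φ := by
  have ma := h.mid_ne_a
  have mb := h.mid_ne_b
  have mc := h.mid_ne_c
  have hca := h.ca
  have hbc := h.bc
  have n1 := h.son₁.mid_ne_a
  have n2 := h.son₁.mid_ne_b
  have n3 := h.son₁.mid_ne_c
  have l1 := h.son₂.mid_ne_a
  have l2 := h.son₂.mid_ne_b
  have l3 := h.son₂.mid_ne_c
  simp only [Elem.son₁, Elem.son₂] at n1 n2 n3 l1 l2 l3
  set n := T.son₁.mid with hn
  set l := T.son₂.mid with hl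
  simp only [Elem.son₁, Elem.son₂] at hn hl
  simp only [← hn, ← hl] at n1 n2 n3 l1 l2 l3
  -- `M'` lists the edges of the two sons that end up halved, `M''` those of the four grandsons. The
  -- edge from `T.mid` to `T.c` is in both sets: it is halved only by the last two bisections, on
  -- both of its sides.
  set M' : Set (Edge d) := {s(T.b, T.c), s(T.c, T.a), s(T.mid, T.c)} with hM'
  set M'' : Set (Edge d) := {s(T.mid, T.c)} with hM''
  have bis : ∀ U : Elem d, U.refEdge ∈ M'' → U.bisectIf M'' = U.bisect := fun U hU => if_pos hU
  have h₁₁ : ∃ Φ, IsSubdiv M'' T.son₁.son₁ T.son₁.son₁.bisect Φ := by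
    rw [← bis _ (by simp [refEdge, Elem.son₁, hM''])]
    refine exists_isSubdiv_bisectIf h.son₁.son₁ ?_ ?_ <;>
      simp [Elem.son₁, ← hn, hM'', n1, n2, n3, ma, mb, mc, hca, hbc, mc.symm, n3.symm, n1.symm]
  have h₁₂ : IsSubdiv M'' T.son₁.son₂ {T.son₁.son₂} id := by
    refine isSubdiv_singleton ?_ ?_ ?_ <;>
      simp [Elem.son₁, Elem.son₂, ← hn, hM'', n1, n2, n3, ma, mb, mc, hca, hbc, hca.symm, ma.symm]
  have h₂₁ : IsSubdiv M'' T.son₂.son₁ {T.son₂.son₁} id := by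
    refine isSubdiv_singleton ?_ ?_ ?_ <;>
      simp [Elem.son₁, Elem.son₂, ← hl, hM'', l1, l2, l3, ma, mb, mc, hca, hbc, hca.symm, ma.symm]
  have h₂₂ : ∃ Φ, IsSubdiv M'' T.son₂.son₂ T.son₂.son₂.bisect Φ := by
    rw [← bis _ (by simp [refEdge, Elem.son₂, hM''])]
    refine exists_isSubdiv_bisectIf h.son₂.son₂ ?_ ?_ <;>
      simp [Elem.son₂, ← hl, hM'', l1, l2, l3, ma, mb, mc, hca, hbc, mc.symm, l3.symm, l1.symm]
  obtain ⟨Φ₁₁, h₁₁⟩ := h₁₁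
  obtain ⟨Φ₂₂, h₂₂⟩ := h₂₂
  have h₁ := isSubdiv_bisect (M := M') h.son₁ (by simp [hM', Elem.son₁])
    (by simp [hM', hM'', Elem.son₁, ma, mb, mc, hca.symm])
    (by simp [hM', hM'', Elem.son₁]) (by simp [← hn, hM'', Elem.son₁, n3, n1, mc.symm])
    (by simp [← hn, hM'', Elem.son₁, n3, n1]) h₁₁ h₁₂
  have h₂ := isSubdiv_bisect (M := M') h.son₂ (by simp [hM', Elem.son₂])
    (by simp [hM', hM'', Elem.son₂])
    (by simp [hM', hM'', Elem.son₂, ma, mb, mc, hbc]) (by simp [← hl, hM'', Elem.son₂, l3, l2, hbc])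
    (by simp [← hl, hM'', Elem.son₂, l3, l2, mc.symm]) h₂₁ h₂₂
  rw [bisec5_eq]
  exact ⟨_, isSubdiv_bisect h (hM (by simp [edges]))
    (iff_of_true (hM (by simp [edges])) (by simp [hM']))
    (iff_of_true (hM (by simp [edges])) (by simp [hM']))
    (by simp [hM', hM'', ma, mb, mc, hca.symm]) (by simp [hM', hM'', ma, mb, mc, hbc]) h₁ h₂⟩

/-- The son of `T` at the node `a` under red refinement. -/
noncomputable def redA (T : Elem d) : Elem d :=
  ⟨T.a, midpoint ℝ T.a T.b, midpoint ℝ T.c T.a, T.gen + 2⟩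

/-- The son of `T` at the node `b` under red refinement. -/
noncomputable def redB (T : Elem d) : Elem d :=
  ⟨midpoint ℝ T.a T.b, T.b, midpoint ℝ T.b T.c, T.gen + 2⟩

/-- The son of `T` at the node `c` under red refinement. -/
noncomputable def redC (T : Elem d) : Elem d :=
  ⟨midpoint ℝ T.c T.a, midpoint ℝ T.b T.c, T.c, T.gen + 2⟩

/-- The interior son of `T` under red refinement. -/
noncomputable def redM (T : Elem d) : Elem d :=
  ⟨midpoint ℝ T.b T.c, midpoint ℝ T.c T.a, midpoint ℝ T.a T.b, T.gen + 2⟩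

theorem red_eq (T : Elem d) : T.red = {redA T, redB T, redC T, redM T} := rfl

open Classical in
/-- The change of barycentric coordinates under red refinement. -/
noncomputable def redMap (T : Elem d) (w : Point d →₀ ℝ) : Point d →₀ ℝ :=
  if 1 / 2 ≤ w T.a then (redA T).bary (2 * w T.a - 1) (2 * w T.b) (2 * w T.c)
  else if 1 / 2 ≤ w T.b then (redB T).bary (2 * w T.a) (2 * w T.b - 1) (2 * w T.c)
  else if 1 / 2 ≤ w T.c then (redC T).bary (2 * w T.a) (2 * w T.b) (2 * w T.c - 1)
  else (redM T).bary (1 - 2 * w T.a) (1 - 2 * w T.b) (1 - 2 * w T.c)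

theorem redMap_bary {T : Elem d} (h : T.Nondegenerate) (α β γ : ℝ) :
    redMap T (T.bary α β γ) =
      if 1 / 2 ≤ α then (redA T).bary (2 * α - 1) (2 * β) (2 * γ)
      else if 1 / 2 ≤ β then (redB T).bary (2 * α) (2 * β - 1) (2 * γ)
      else if 1 / 2 ≤ γ then (redC T).bary (2 * α) (2 * β) (2 * γ - 1)
      else (redM T).bary (1 - 2 * α) (1 - 2 * β) (1 - 2 * γ) := by
  rw [redMap, Elem.bary_apply_a h, Elem.bary_apply_b h, Elem.bary_apply_c h]

theorem red_edge_aux {M : Set (Edge d)} {u v : Point d} (huv : s(u, v) ∈ M) {ξ η : ℝ}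
    (h : ξ + η = 1) : (1 / 2 ≤ ξ →
      seg M u v ξ η = single u (2 * ξ - 1) + single (midpoint ℝ u v) (2 * η)) ∧
    (1 / 2 ≤ η → seg M u v ξ η = single v (2 * η - 1) + single (midpoint ℝ u v) (2 * ξ)) := by
  constructor <;> intro h1
  · rw [seg_of_mem_of_le huv (by linarith)]
    congr 2; linarith
  · rw [seg_comm, seg_of_mem_of_le (by rwa [Sym2.eq_swap]) (by linarith), midpoint_comm]
    congr 2; linarith

theorem toPoint_redA (T : Elem d) (s t r : ℝ) :
    toPoint ((redA T).bary s t r) = toPoint (T.bary (s + t / 2 + r / 2) (t / 2) (r / 2)) := by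
  simp only [toPoint_bary, redA, midpoint_eq_smul_add, invOf_eq_inv]; module

theorem toPoint_redB (T : Elem d) (s t r : ℝ) :
    toPoint ((redB T).bary s t r) = toPoint (T.bary (s / 2) (s / 2 + t + r / 2) (r / 2)) := by
  simp only [toPoint_bary, redB, midpoint_eq_smul_add, invOf_eq_inv]; module

theorem toPoint_redC (T : Elem d) (s t r : ℝ) :
    toPoint ((redC T).bary s t r) = toPoint (T.bary (s / 2) (t / 2) (s / 2 + t / 2 + r)) := by
  simp only [toPoint_bary, redC, midpoint_eq_smul_add, invOf_eq_inv]; module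

theorem toPoint_redM (T : Elem d) (s t r : ℝ) :
    toPoint ((redM T).bary s t r) =
      toPoint (T.bary (t / 2 + r / 2) (s / 2 + r / 2) (s / 2 + t / 2)) := by
  simp only [toPoint_bary, redM, midpoint_eq_smul_add, invOf_eq_inv]; module

theorem redMap_redA {T : Elem d} (h : T.Nondegenerate) {s t r : ℝ} (hs : 0 ≤ s)
    (h1 : s + t + r = 1) :
    redMap T (T.bary (s + t / 2 + r / 2) (t / 2) (r / 2)) = (redA T).bary s t r := by
  rw [redMap_bary h, if_pos (by linarith)]
  congr 1 <;> linarith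

/-- Two corner sons meet only in the midpoint of an edge of `T`; there the earlier branch of
`redMap` applies and gives the same weights. -/
theorem redMap_redB {T : Elem d} (h : T.Nondegenerate) {s t r : ℝ} (ht : 0 ≤ t) (hr : 0 ≤ r)
    (h1 : s + t + r = 1) :
    redMap T (T.bary (s / 2) (s / 2 + t + r / 2) (r / 2)) = (redB T).bary s t r := by
  rw [redMap_bary h]
  split_ifs with i1 i2
  · obtain rfl : s = 1 := by linarith
    obtain rfl : t = 0 := by linarith
    obtain rfl : r = 0 := by linarith
    norm_num [bary, redA, redB]
  · congr 1 <;> linarith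
  all_goals linarith

theorem redMap_redC {T : Elem d} (h : T.Nondegenerate) {s t r : ℝ} (hs : 0 ≤ s) (ht : 0 ≤ t)
    (hr : 0 ≤ r) (h1 : s + t + r = 1) :
    redMap T (T.bary (s / 2) (t / 2) (s / 2 + t / 2 + r)) = (redC T).bary s t r := by
  rw [redMap_bary h]
  split_ifs with i1 i2
  · obtain rfl : s = 1 := by linarith
    obtain rfl : t = 0 := by linarith
    obtain rfl : r = 0 := by linarith
    norm_num [bary, redA, redC]
  · obtain rfl : t = 1 := by linarith
    obtain rfl : s = 0 := by linarith
    obtain rfl : r = 0 := by linarith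
    norm_num [bary, redB, redC]
  · congr 1 <;> linarith
  all_goals linarith

/-- The interior son meets each corner son in an edge, where one of `s`, `t`, `r` vanishes and the
formulas of both sons give the same weights. -/
theorem redMap_redM {T : Elem d} (h : T.Nondegenerate) {s t r : ℝ} (hs : 0 ≤ s) (ht : 0 ≤ t)
    (hr : 0 ≤ r) (h1 : s + t + r = 1) :
    redMap T (T.bary (t / 2 + r / 2) (s / 2 + r / 2) (s / 2 + t / 2)) = (redM T).bary s t r := by
  rw [redMap_bary h]
  split_ifs with i1 i2 i3
  · obtain rfl : s = 0 := by linarith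
    obtain rfl : t = 1 - r := by linarith
    simp only [bary, redA, redM]
    rw [show 2 * ((1 - r) / 2 + r / 2) - 1 = 0 by ring, show 2 * (0 / 2 + r / 2) = r by ring,
      show 2 * (0 / 2 + (1 - r) / 2) = 1 - r by ring]
    simp only [single_zero, zero_add]
    abel
  · obtain rfl : t = 0 := by linarith
    obtain rfl : s = 1 - r := by linarith
    simp only [bary, redB, redM]
    rw [show 2 * (0 / 2 + r / 2) = r by ring, show 2 * ((1 - r) / 2 + r / 2) - 1 = 0 by ring,
      show 2 * ((1 - r) / 2 + 0 / 2) = 1 - r by ring]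
    simp only [single_zero]
    abel
  · obtain rfl : r = 0 := by linarith
    obtain rfl : t = 1 - s := by linarith
    simp only [bary, redC, redM]
    rw [show 2 * ((1 - s) / 2 + 0 / 2) = 1 - s by ring, show 2 * (s / 2 + 0 / 2) = s by ring,
      show 2 * (s / 2 + (1 - s) / 2) - 1 = 0 by ring]
    simp only [single_zero]
    abel
  · congr 1 <;> linarith

theorem isSubdiv_red {M : Set (Edge d)} {T : Elem d} (h : T.Nondegenerate) (hM : T.edges ⊆ M) :
    IsSubdiv M T T.red (redMap T) := by
  have hab : s(T.a, T.b) ∈ M := hM (by simp [edges])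
  have hbc : s(T.b, T.c) ∈ M := hM (by simp [edges])
  have hca : s(T.c, T.a) ∈ M := hM (by simp [edges])
  refine IsSubdiv.mk' ?_ ?_ ?_ ?_ ?_
  · rw [red_eq]
    rintro S (rfl | rfl | rfl | rfl) _ ⟨s, t, r, hs, ht, hr, h1, rfl⟩
    · refine ⟨_, ⟨_, _, _, ?_, ?_, ?_, ?_, rfl⟩, (toPoint_redA T s t r).symm,
        redMap_redA h hs h1, fun hp => ?_⟩
      iterate 3 positivity
      · linarith
      · rw [isPos_bary (h.mem_red (by simp [red_eq]))] at hp
        obtain ⟨h1, h2, h3⟩ := hp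
        rw [isPos_bary h]
        exact ⟨by positivity, by positivity, by positivity⟩
    · refine ⟨_, ⟨_, _, _, ?_, ?_, ?_, ?_, rfl⟩, (toPoint_redB T s t r).symm,
        redMap_redB h ht hr h1, fun hp => ?_⟩
      iterate 3 positivity
      · linarith
      · rw [isPos_bary (h.mem_red (by simp [red_eq]))] at hp
        obtain ⟨h1, h2, h3⟩ := hp
        rw [isPos_bary h]
        exact ⟨by positivity, by positivity, by positivity⟩
    · refine ⟨_, ⟨_, _, _, ?_, ?_, ?_, ?_, rfl⟩, (toPoint_redC T s t r).symm,
        redMap_redC h hs ht hr h1, fun hp => ?_⟩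
      iterate 3 positivity
      · linarith
      · rw [isPos_bary (h.mem_red (by simp [red_eq]))] at hp
        obtain ⟨h1, h2, h3⟩ := hp
        rw [isPos_bary h]
        exact ⟨by positivity, by positivity, by positivity⟩
    · refine ⟨_, ⟨_, _, _, ?_, ?_, ?_, ?_, rfl⟩, (toPoint_redM T s t r).symm,
        redMap_redM h hs ht hr h1, fun hp => ?_⟩
      iterate 3 positivity
      · linarith
      · rw [isPos_bary (h.mem_red (by simp [red_eq]))] at hp
        obtain ⟨h1, h2, h3⟩ := hp
        rw [isPos_bary h]
        exact ⟨by positivity, by positivity, by positivity⟩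
  · intro ξ η hξ hη h1
    rw [redMap_bary h]
    split_ifs with i1 i2 i3
    · rw [(red_edge_aux hab h1).1 i1]; simp [bary, redA]
    · rw [(red_edge_aux hab h1).2 i2]; simp [bary, redB, add_comm]
    all_goals linarith
  · intro ξ η hξ hη h1
    rw [redMap_bary h]
    split_ifs with i1 i2 i3
    · linarith
    · rw [(red_edge_aux hbc h1).1 i2]; simp [bary, redB]
    · rw [(red_edge_aux hbc h1).2 i3]; simp [bary, redC, add_comm]
    · linarith
  · intro ξ η hξ hη h1
    rw [redMap_bary h]
    split_ifs with i1 i2 i3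
    · rw [(red_edge_aux hca h1).2 i1]; simp [bary, redA]
    · linarith
    · rw [(red_edge_aux hca h1).1 i3]; simp [bary, redC, add_comm]
    · linarith
  · intro S hS S' hS' μ hp hμ hμ'
    have hd := h.mem_red hS
    obtain ⟨s, t, r, hs, ht, hr, h1, rfl⟩ := hμ
    obtain ⟨hs', ht', hr'⟩ := (isPos_bary hd).1 hp
    obtain ⟨s', t', r', is, it, ir, h1', e⟩ := hμ'
    have e := congrArg toPoint e
    rw [red_eq] at hS hS'
    rcases hS with rfl | rfl | rfl | rfl <;> rcases hS' with rfl | rfl | rfl | rfl <;>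
      -- A corner son is the region where one coordinate of `T` is at least `1 / 2`, the interior
      -- son the region where all are at most `1 / 2`. Positive weights make the relevant inequality
      -- strict, so different sons contradict each other.
      first
      | rfl
      | (exfalso
         simp only [toPoint_redA, toPoint_redB, toPoint_redC, toPoint_redM] at e
         rw [toPoint_bary, toPoint_bary] at e
         obtain ⟨e1, e2, e3⟩ := h.coord_unique (by linarith) e
         linarith)

/-- With three marked edges, newest vertex bisection performs three bisections. It is therefore the
modified rule with constant pattern, and both algorithms can be treated together. -/
theorem nvbRefine_eq_mnvbRefine (M : Set (Edge d)) (T : Elem d) :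
    T.nvbRefine M = T.mnvbRefine M .bisec3 := by
  unfold mnvbRefine
  split_ifs with hT
  · have h1 : T.refEdge ∈ M := hT (by simp [edges, refEdge])
    have h2 : T.son₁.refEdge ∈ M := hT (by simp [edges, refEdge, Elem.son₁])
    have h3 : T.son₂.refEdge ∈ M := hT (by simp [edges, refEdge, Elem.son₂])
    rw [nvbRefine, if_pos h1, bisectIf, bisectIf, if_pos h2, if_pos h3]
    rfl
  · rfl

theorem exists_isSubdiv_mnvbRefine {M : Set (Edge d)} {T : Elem d} (h : T.Nondegenerate)
    (hM : ∀ E ∈ T.edges, E ∈ M → T.refEdge ∈ M) (p : Pattern) :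
    ∃ Φ, IsSubdiv M T (T.mnvbRefine M p) Φ := by
  unfold mnvbRefine
  split_ifs with hT
  · cases p with
    | bisec3 =>
      have := nvbRefine_eq_mnvbRefine M T
      rw [mnvbRefine, if_pos hT] at this
      rw [← this]
      exact exists_isSubdiv_nvbRefine h hM
    | red => exact ⟨_, isSubdiv_red h hT⟩
    | bisec5 => exact exists_isSubdiv_bisec5 h hT
  · exact exists_isSubdiv_nvbRefine h hM

end NVB

/-! ### Conformity is preserved by refinement -/

namespace NVB

open Finsupp

variable {d : ℕ}

open Elem

theorem Edge.carrier_mk (u v : Point d) : Edge.carrier s(u, v) = segment ℝ u v := by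
  rw [← convexHull_pair]
  unfold Edge.carrier
  congr 1
  ext x
  simp

namespace Elem

variable {T : Elem d}

theorem isBary_edge {u v : Point d} (huv : s(u, v) ∈ T.edges) {ξ η : ℝ} (hξ : 0 ≤ ξ) (hη : 0 ≤ η)
    (h1 : ξ + η = 1) : T.IsBary (single u ξ + single v η) := by
  simp only [Elem.edges, Set.mem_insert_iff, Set.mem_singleton_iff, Sym2.eq_iff] at huv
  rcases huv with (⟨rfl, rfl⟩ | ⟨rfl, rfl⟩) | (⟨rfl, rfl⟩ | ⟨rfl, rfl⟩) | (⟨rfl, rfl⟩ | ⟨rfl, rfl⟩)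
  · exact ⟨ξ, η, 0, hξ, hη, le_rfl, by linarith, by simp [bary]⟩
  · exact ⟨η, ξ, 0, hη, hξ, le_rfl, by linarith, by simp [bary, add_comm]⟩
  · exact ⟨0, ξ, η, le_rfl, hξ, hη, by linarith, by simp [bary]⟩
  · exact ⟨0, η, ξ, le_rfl, hη, hξ, by linarith, by simp [bary, add_comm]⟩
  · exact ⟨η, 0, ξ, hη, le_rfl, hξ, by linarith, by simp [bary, add_comm]⟩
  · exact ⟨ξ, 0, η, hξ, le_rfl, hη, by linarith, by simp [bary]⟩

theorem isBary_node {x : Point d} (hx : x ∈ T.nodes) : T.IsBary (single x 1) := by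
  rcases hx with rfl | rfl | rfl
  · exact ⟨1, 0, 0, by norm_num, le_rfl, le_rfl, by norm_num, by simp [bary]⟩
  · exact ⟨0, 1, 0, le_rfl, by norm_num, le_rfl, by norm_num, by simp [bary]⟩
  · exact ⟨0, 0, 1, le_rfl, le_rfl, by norm_num, by norm_num, by simp [bary]⟩

theorem mem_nodes_of_isBary {x : Point d} {μ : Point d →₀ ℝ} (hμ : T.IsBary μ) (hx : μ x ≠ 0) :
    x ∈ T.nodes := by
  obtain ⟨s, t, r, -, -, -, -, rfl⟩ := hμ
  by_contra h
  simp only [nodes, Set.mem_insert_iff, Set.mem_singleton_iff, not_or] at h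
  exact hx (by simp [bary, h.1, h.2.1, h.2.2])

theorem nodes_of_mem_edges {u v : Point d} (huv : s(u, v) ∈ T.edges) :
    u ∈ T.nodes ∧ v ∈ T.nodes := by
  simp only [Elem.edges, Set.mem_insert_iff, Set.mem_singleton_iff, Sym2.eq_iff] at huv
  rcases huv with (⟨rfl, rfl⟩ | ⟨rfl, rfl⟩) | (⟨rfl, rfl⟩ | ⟨rfl, rfl⟩) | (⟨rfl, rfl⟩ | ⟨rfl, rfl⟩) <;>
    simp [nodes]

theorem mem_edges_of_nodes {u v : Point d} (hu : u ∈ T.nodes) (hv : v ∈ T.nodes) (h : u ≠ v) :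
    s(u, v) ∈ T.edges := by
  rcases hu with rfl | rfl | rfl <;> rcases hv with rfl | rfl | rfl <;>
    first
    | exact absurd rfl h
    | simp [edges]

theorem Nondegenerate.ne_of_mem_edges (h : T.Nondegenerate) {u v : Point d}
    (huv : s(u, v) ∈ T.edges) : u ≠ v := by
  simp only [Elem.edges, Set.mem_insert_iff, Set.mem_singleton_iff, Sym2.eq_iff] at huv
  rcases huv with (⟨rfl, rfl⟩ | ⟨rfl, rfl⟩) | (⟨rfl, rfl⟩ | ⟨rfl, rfl⟩) | (⟨rfl, rfl⟩ | ⟨rfl, rfl⟩)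
  exacts [h.ab, h.ab.symm, h.bc, h.bc.symm, h.ca, h.ca.symm]

theorem mem_carrier_of_mem_nodes {x : Point d} (hx : x ∈ T.nodes) : x ∈ T.carrier :=
  subset_convexHull ℝ _ hx

theorem not_isPos_edge (h : T.Nondegenerate) (u v : Point d) (ξ η : ℝ) :
    ¬ T.IsPos (single u ξ + single v η) := by
  have key : ∀ x, 0 < (single u ξ + single v η) x → x = u ∨ x = v := by
    intro x hx
    by_contra! hne
    simp [hne.1, hne.2] at hx
  rintro ⟨ha, hb, hc⟩
  have := h.ab
  have := h.bc
  have := h.ca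
  have := key _ ha
  have := key _ hb
  have := key _ hc
  grind

theorem exists_edge_of_not_isPos (h : T.Nondegenerate) {w : Point d →₀ ℝ} (hw : T.IsBary w)
    (hp : ¬ T.IsPos w) : ∃ u v, ∃ ξ η : ℝ, s(u, v) ∈ T.edges ∧ 0 ≤ ξ ∧ 0 ≤ η ∧ ξ + η = 1 ∧
      w = single u ξ + single v η := by
  obtain ⟨s, t, r, hs, ht, hr, h1, rfl⟩ := hw
  rw [isPos_bary h] at hp
  rcases eq_or_lt_of_le hs with rfl | hs
  · exact ⟨T.b, T.c, t, r, by simp [edges], ht, hr, by linarith, by simp [bary]⟩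
  rcases eq_or_lt_of_le ht with rfl | ht
  · exact ⟨T.c, T.a, r, s, by simp [edges], hr, hs.le, by linarith, by simp [bary, add_comm]⟩
  rcases eq_or_lt_of_le hr with rfl | hr
  · exact ⟨T.a, T.b, s, t, by simp [edges], hs.le, ht.le, by linarith, by simp [bary]⟩
  exact absurd ⟨hs, ht, hr⟩ hp

end Elem

/-- Equal weights belong to the same edge up to orientation, except at end points, and there `seg`
does not see whether the edge is marked. -/
theorem seg_eq_of_eq (M : Set (Edge d)) {u v u' v' : Point d} {ξ η ξ' η' : ℝ} (huv : u ≠ v)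
    (huv' : u' ≠ v') (hξ : 0 ≤ ξ) (hη : 0 ≤ η) (h1 : ξ + η = 1) (hξ' : 0 ≤ ξ') (hη' : 0 ≤ η')
    (h1' : ξ' + η' = 1) (e : single u ξ + single v η = single u' ξ' + single v' η') :
    seg M u v ξ η = seg M u' v' ξ' η' := by
  have eu : ξ = (single u' ξ' + single v' η') u := by rw [← e]; simp [huv.symm]
  have ev : η = (single u' ξ' + single v' η') v := by rw [← e]; simp [huv]
  have eu' : ξ' = (single u ξ + single v η) u' := by rw [e]; simp [huv'.symm]
  have ev' : η' = (single u ξ + single v η) v' := by rw [e]; simp [huv']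
  by_cases h00 : u = u'
  · subst h00
    by_cases h11 : v = v'
    · subst h11
      obtain rfl : ξ = ξ' := by simpa [huv] using eu
      obtain rfl : η = η' := by linarith
      rfl
    · have : η = 0 := by simpa [huv.symm, Ne.symm h11] using ev
      subst this
      have : η' = 0 := by simpa [huv'.symm, h11] using ev'
      subst this
      rw [seg_zero_right _ _ _ hξ, seg_zero_right _ _ _ hξ']
      congr 1; linarith
  · by_cases h01 : u = v'
    · subst h01
      by_cases h10 : v = u'
      · subst h10
        obtain rfl : ξ = η' := by simpa [huv] using eu
        obtain rfl : η = ξ' := by linarith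
        exact seg_comm _ _ _ _ _
      · have : η = 0 := by simpa [Ne.symm h10, huv.symm] using ev
        subst this
        have : ξ' = 0 := by simpa [huv', Ne.symm h10, h10, h00] using eu'
        subst this
        rw [seg_zero_right _ _ _ hξ, seg_zero_left _ _ _ hη']
        congr 1; linarith
    · have : ξ = 0 := by simpa [Ne.symm h00, Ne.symm h01] using eu
      subst this
      have hη1 : η = 1 := by linarith
      subst hη1
      rw [seg_zero_left _ _ _ hη]
      by_cases h10 : v = u'
      · subst h10
        have : ξ' = 1 := by simpa [huv] using eu'
        subst this
        obtain rfl : η' = 0 := by linarith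
        rw [seg_zero_right _ _ _ hξ']
      · have : ξ' = 0 := by simpa [h10, h00] using eu'
        subst this
        obtain rfl : η' = 1 := by linarith
        have : v = v' := by
          by_contra h11
          simp [h11] at ev'
        subst this
        rw [seg_zero_left _ _ _ hη']

/-- Conformity in terms of barycentric coordinates: they depend on the point only, and an interior
point of an element is in no other element. -/
structure IsConforming (𝒯 : Set (Elem d)) : Prop where
  nondegenerate : ∀ T ∈ 𝒯, T.Nondegenerate
  bary_eq : ∀ T₁ ∈ 𝒯, ∀ T₂ ∈ 𝒯, ∀ μ₁ μ₂, T₁.IsBary μ₁ → T₂.IsBary μ₂ →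
    toPoint μ₁ = toPoint μ₂ → μ₁ = μ₂
  unique : ∀ T₁ ∈ 𝒯, ∀ T₂ ∈ 𝒯, ∀ μ, T₁.IsPos μ → T₁.IsBary μ → T₂.IsBary μ → T₁ = T₂

/-- A point common to descendants of two different elements has the same weights in both elements,
and by uniqueness these are interior to neither. So they are weights on an edge of each element,
where both changes of coordinates are `seg M` and hence agree. -/
theorem IsConforming.refine {𝒯 : Set (Elem d)} (h : IsConforming 𝒯) {M : Set (Edge d)}
    {R : Elem d → Set (Elem d)} (hR : ∀ T ∈ 𝒯, ∃ Φ, IsSubdiv M T (R T) Φ)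
    (hnd : ∀ T ∈ 𝒯, ∀ S ∈ R T, S.Nondegenerate) : IsConforming (⋃ T ∈ 𝒯, R T) where
  nondegenerate := by
    intro S hS
    simp only [Set.mem_iUnion, exists_prop] at hS
    obtain ⟨T, hT, hS⟩ := hS
    exact hnd T hT S hS
  bary_eq := by
    intro S₁ hS₁ S₂ hS₂ μ₁ μ₂ hμ₁ hμ₂ e
    simp only [Set.mem_iUnion, exists_prop] at hS₁ hS₂
    obtain ⟨T₁, hT₁, hS₁⟩ := hS₁
    obtain ⟨T₂, hT₂, hS₂⟩ := hS₂
    obtain ⟨Φ₁, hΦ₁⟩ := hR T₁ hT₁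
    by_cases hT : T₁ = T₂
    · subst hT
      obtain ⟨w₁, hw₁, e₁, rfl, -⟩ := hΦ₁.lift S₁ hS₁ μ₁ hμ₁
      obtain ⟨w₂, hw₂, e₂, rfl, -⟩ := hΦ₁.lift S₂ hS₂ μ₂ hμ₂
      rw [h.bary_eq T₁ hT₁ T₁ hT₁ w₁ w₂ hw₁ hw₂ (by rw [e₁, e₂, e])]
    · obtain ⟨Φ₂, hΦ₂⟩ := hR T₂ hT₂
      obtain ⟨w₁, hw₁, e₁, rfl, -⟩ := hΦ₁.lift S₁ hS₁ μ₁ hμ₁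
      obtain ⟨w₂, hw₂, e₂, rfl, -⟩ := hΦ₂.lift S₂ hS₂ μ₂ hμ₂
      obtain rfl := h.bary_eq T₁ hT₁ T₂ hT₂ w₁ w₂ hw₁ hw₂ (by rw [e₁, e₂, e])
      have hn₁ : ¬ T₁.IsPos w₁ := fun hp => hT (h.unique T₁ hT₁ T₂ hT₂ w₁ hp hw₁ hw₂)
      have hn₂ : ¬ T₂.IsPos w₁ := fun hp => hT (h.unique T₂ hT₂ T₁ hT₁ w₁ hp hw₂ hw₁).symm
      obtain ⟨u, v, ξ, η, huv, hξ, hη, h1, f₁⟩ :=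
        exists_edge_of_not_isPos (h.nondegenerate T₁ hT₁) hw₁ hn₁
      obtain ⟨u', v', ξ', η', huv', hξ', hη', h1', f₂⟩ :=
        exists_edge_of_not_isPos (h.nondegenerate T₂ hT₂) hw₂ hn₂
      have g₁ := hΦ₁.edge u v huv ξ η hξ hη h1
      have g₂ := hΦ₂.edge u' v' huv' ξ' η' hξ' hη' h1'
      rw [← f₁] at g₁
      rw [← f₂] at g₂
      rw [g₁, g₂]
      exact seg_eq_of_eq M ((h.nondegenerate T₁ hT₁).ne_of_mem_edges huv)
        ((h.nondegenerate T₂ hT₂).ne_of_mem_edges huv') hξ hη h1 hξ' hη' h1' (f₁.symm.trans f₂)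
  unique := by
    intro S₁ hS₁ S₂ hS₂ μ hp hμ₁ hμ₂
    simp only [Set.mem_iUnion, exists_prop] at hS₁ hS₂
    obtain ⟨T₁, hT₁, hS₁⟩ := hS₁
    obtain ⟨T₂, hT₂, hS₂⟩ := hS₂
    obtain ⟨Φ₁, hΦ₁⟩ := hR T₁ hT₁
    obtain ⟨Φ₂, hΦ₂⟩ := hR T₂ hT₂
    obtain ⟨w₁, hw₁, e₁, -, p₁⟩ := hΦ₁.lift S₁ hS₁ μ hμ₁
    obtain ⟨w₂, hw₂, e₂, -, -⟩ := hΦ₂.lift S₂ hS₂ μ hμ₂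
    obtain rfl := h.bary_eq T₁ hT₁ T₂ hT₂ w₁ w₂ hw₁ hw₂ (by rw [e₁, e₂])
    obtain rfl := h.unique T₁ hT₁ T₂ hT₂ w₁ (p₁ hp) hw₁ hw₂
    exact hΦ₁.unique S₁ hS₁ S₂ hS₂ μ hp hμ₁ hμ₂

theorem IsMeshOn.exists_common_edge {Ω : Set (Point d)} {𝒯 : Set (Elem d)} (h : IsMeshOn Ω 𝒯)
    {T₁ T₂ : Elem d} (hT₁ : T₁ ∈ 𝒯) (hT₂ : T₂ ∈ 𝒯) (hne : T₁ ≠ T₂) {x : Point d}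
    (hx₁ : x ∈ T₁.carrier) (hx₂ : x ∈ T₂.carrier) :
    ∃ u v, ∃ ξ η : ℝ, T₁.IsBary (single u ξ + single v η) ∧ T₂.IsBary (single u ξ + single v η) ∧
      toPoint (single u ξ + single v η) = x := by
  have hx : x ∈ T₁.carrier ∩ T₂.carrier := ⟨hx₁, hx₂⟩
  rcases h.conforming T₁ hT₁ T₂ hT₂ hne with e | ⟨y, ⟨hy₁, hy₂⟩, e⟩ | ⟨E, ⟨hE₁, hE₂⟩, e⟩
  · rw [e] at hx
    exact hx.elim
  · rw [e] at hx
    obtain rfl := hx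
    -- A common node is treated as a degenerate edge with both end points equal.
    exact ⟨x, x, 1, 0, by simpa using isBary_node hy₁, by simpa using isBary_node hy₂, by simp⟩
  · induction E using Sym2.ind with | _ u v =>
    rw [e, Edge.carrier_mk] at hx
    obtain ⟨ξ, η, hξ, hη, h1, rfl⟩ := hx
    exact ⟨u, v, ξ, η, isBary_edge hE₁ hξ hη h1, isBary_edge hE₂ hξ hη h1, by simp⟩

theorem IsMeshOn.isConforming {Ω : Set (Point d)} {𝒯 : Set (Elem d)} (h : IsMeshOn Ω 𝒯) :
    IsConforming 𝒯 where
  nondegenerate := h.nondegenerate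
  bary_eq := by
    intro T₁ hT₁ T₂ hT₂ μ₁ μ₂ hμ₁ hμ₂ e
    by_cases hT : T₁ = T₂
    · subst hT
      exact (h.nondegenerate T₁ hT₁).bary_unique hμ₁ hμ₂ e
    · obtain ⟨u, v, ξ, η, h₁, h₂, e'⟩ := h.exists_common_edge hT₁ hT₂ hT
        (mem_carrier_iff.2 ⟨μ₁, hμ₁, rfl⟩) (mem_carrier_iff.2 ⟨μ₂, hμ₂, e.symm⟩)
      rw [(h.nondegenerate T₁ hT₁).bary_unique hμ₁ h₁ e'.symm,
        (h.nondegenerate T₂ hT₂).bary_unique hμ₂ h₂ (e.symm.trans e'.symm)]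
  unique := by
    intro T₁ hT₁ T₂ hT₂ μ hp hμ₁ hμ₂
    by_contra hT
    obtain ⟨u, v, ξ, η, h₁, h₂, e⟩ := h.exists_common_edge hT₁ hT₂ hT
      (mem_carrier_iff.2 ⟨μ, hμ₁, rfl⟩) (mem_carrier_iff.2 ⟨μ, hμ₂, rfl⟩)
    rw [(h.nondegenerate T₁ hT₁).bary_unique hμ₁ h₁ e.symm] at hp
    exact not_isPos_edge (h.nondegenerate T₁ hT₁) _ _ _ _ hp

/-- `S` is a son of `T` under bisection or red refinement. -/
def IsSon (T S : Elem d) : Prop := S ∈ T.bisect ∨ S ∈ T.red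

theorem reflTransGen_isSon_of_mem_bisectIf {M : Set (Edge d)} {T S : Elem d}
    (h : S ∈ T.bisectIf M) : Relation.ReflTransGen IsSon T S := by
  unfold bisectIf at h
  split_ifs at h
  · exact .single (.inl h)
  · rw [Set.mem_singleton_iff.1 h]

theorem reflTransGen_isSon_of_mem_nvbRefine {M : Set (Edge d)} {T S : Elem d}
    (h : S ∈ T.nvbRefine M) : Relation.ReflTransGen IsSon T S := by
  unfold nvbRefine at h
  split_ifs at h
  · rcases h with h | h
    · exact .head (.inl (.inl rfl)) (reflTransGen_isSon_of_mem_bisectIf h)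
    · exact .head (.inl (.inr rfl)) (reflTransGen_isSon_of_mem_bisectIf h)
  · rw [Set.mem_singleton_iff.1 h]

theorem reflTransGen_isSon_of_mem_mnvbRefine {M : Set (Edge d)} {p : Pattern} {T S : Elem d}
    (h : S ∈ T.mnvbRefine M p) : Relation.ReflTransGen IsSon T S := by
  have h₁ : IsSon T T.son₁ := .inl (.inl rfl)
  have h₂ : IsSon T T.son₂ := .inl (.inr rfl)
  unfold mnvbRefine at h
  split_ifs at h
  · cases p with
    | bisec3 =>
      rcases h with h | h
      · exact .head h₁ (.single (.inl h))
      · exact .head h₂ (.single (.inl h))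
    | red => exact .single (.inr h)
    | bisec5 =>
      rcases h with ((rfl | rfl) | h) | h
      · exact .head h₁ (.single (.inl (.inr rfl)))
      · exact .head h₂ (.single (.inl (.inl rfl)))
      · exact .head h₁ (.head (.inl (.inl rfl)) (.single (.inl h)))
      · exact .head h₂ (.head (.inl (.inr rfl)) (.single (.inl h)))
  · exact reflTransGen_isSon_of_mem_nvbRefine h

/-- A property which is inherited by sons is inherited by descendants. -/
theorem of_reflTransGen_isSon {P : Elem d → Prop} (h₁ : ∀ T, P T → P T.son₁)
    (h₂ : ∀ T, P T → P T.son₂) (hr : ∀ T, P T → ∀ S ∈ T.red, P S) {T S : Elem d} (hT : P T)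
    (h : Relation.ReflTransGen IsSon T S) : P S := by
  induction h with
  | refl => exact hT
  | tail _ h ih =>
    rcases h with (rfl | rfl) | h
    exacts [h₁ _ ih, h₂ _ ih, hr _ ih _ h]

theorem nondegenerate_of_reflTransGen {T S : Elem d} (hT : T.Nondegenerate)
    (h : Relation.ReflTransGen IsSon T S) : S.Nondegenerate :=
  of_reflTransGen_isSon (P := Nondegenerate) (fun _ h => h.son₁) (fun _ h => h.son₂)
    (fun _ h _ hS => h.mem_red hS) hT h

theorem carrier_subset_of_reflTransGen {T S : Elem d} (h : Relation.ReflTransGen IsSon T S) :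
    S.carrier ⊆ T.carrier :=
  of_reflTransGen_isSon (P := fun S => S.carrier ⊆ T.carrier)
    (fun U hU => U.son₁_carrier_subset.trans hU) (fun U hU => U.son₂_carrier_subset.trans hU)
    (fun _ hU _ hS => (carrier_subset_of_mem_red hS).trans hU) subset_rfl h

theorem IsSuccessor.reflTransGen {T S : Elem d} (h : IsSuccessor T S) :
    Relation.ReflTransGen IsSon T S :=
  Relation.ReflTransGen.mono (fun _ _ h' => .inl h') _ _ h

/-- One call of a refinement algorithm, with a set of marked edges which is closed. -/
def RefineStep (𝒯 𝒯' : Set (Elem d)) : Prop :=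
  ∃ M : Set (Edge d), (∀ T ∈ 𝒯, ∀ E ∈ T.edges, E ∈ M → T.refEdge ∈ M) ∧
    ∃ p : Elem d → Pattern, 𝒯' = ⋃ T ∈ 𝒯, T.mnvbRefine M (p T)

/-- The sets of marks increase by definition, so a stop without strict growth means that the final
set is closed. -/
theorem MNVBStep.refineStep {𝒯 𝒯' : Set (Elem d)} (h : MNVBStep 𝒯 𝒯') : RefineStep 𝒯 𝒯' := by
  obtain ⟨ℳ, -, M₀, -, M, ⟨k, -, hk, rfl⟩, p, rfl⟩ := h
  refine ⟨_, ?_, p, rfl⟩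
  intro T hT E hE hEM
  by_contra hc
  refine hk ⟨Set.subset_union_left, fun hsub => hc (hsub (.inr ⟨T, hT, ⟨E, hEM, hE⟩, rfl⟩))⟩

/-- Here the next set of marks does not contain the previous one by definition. It does so because
all marks are reference edges of elements of `𝒯`, and a marked reference edge marks itself again. -/
theorem NVBStep.refineStep {𝒯 𝒯' : Set (Elem d)} (h : NVBStep 𝒯 𝒯') : RefineStep 𝒯 𝒯' := by
  obtain ⟨ℳ, hℳ, M, ⟨k, -, hk, rfl⟩, rfl⟩ := h
  have href : ∀ k, ∀ E ∈ nvbMarks 𝒯 (refEdge '' ℳ) k, ∃ T ∈ 𝒯, E = T.refEdge := by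
    intro k E hE
    cases k with
    | zero =>
      obtain ⟨T, hT, rfl⟩ := hE
      exact ⟨T, hℳ hT, rfl⟩
    | succ k =>
      obtain ⟨T, hT, -, rfl⟩ := hE
      exact ⟨T, hT, rfl⟩
  refine ⟨nvbMarks 𝒯 (refEdge '' ℳ) k, ?_, fun _ => .bisec3, by simp only [nvbRefine_eq_mnvbRefine]⟩
  intro T hT E hE hEM
  by_contra hc
  refine hk ⟨fun E' hE' => ?_, fun hsub => hc (hsub ⟨T, hT, ⟨E, hEM, hE⟩, rfl⟩)⟩
  obtain ⟨T', hT', rfl⟩ := href k _ hE'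
  exact ⟨T', hT', ⟨_, hE', by simp [edges, refEdge]⟩, rfl⟩

theorem RefineStep.isConforming {𝒯 𝒯' : Set (Elem d)} (h : RefineStep 𝒯 𝒯')
    (h𝒯 : IsConforming 𝒯) : IsConforming 𝒯' := by
  obtain ⟨M, hM, p, rfl⟩ := h
  exact h𝒯.refine (M := M)
    (fun T hT => exists_isSubdiv_mnvbRefine (h𝒯.nondegenerate T hT) (hM T hT) (p T))
    (fun T hT S hS => nondegenerate_of_reflTransGen (h𝒯.nondegenerate T hT)
      (reflTransGen_isSon_of_mem_mnvbRefine hS))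

/-- `𝒯` is a conforming mesh of descendants of elements of `𝒯₀`. -/
structure IsRefinement (𝒯₀ 𝒯 : Set (Elem d)) : Prop where
  isConforming : IsConforming 𝒯
  ancestor : ∀ T ∈ 𝒯, ∃ S ∈ 𝒯₀, Relation.ReflTransGen IsSon S T

theorem isRefinement_of_reflTransGen {𝒯₀ 𝒯 : Set (Elem d)} (h₀ : IsConforming 𝒯₀)
    (h : Relation.ReflTransGen RefineStep 𝒯₀ 𝒯) : IsRefinement 𝒯₀ 𝒯 := by
  induction h with
  | refl => exact ⟨h₀, fun T hT => ⟨T, hT, .refl⟩⟩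
  | tail _ h ih =>
    refine ⟨h.isConforming ih.isConforming, ?_⟩
    obtain ⟨M, -, p, rfl⟩ := h
    intro S hS
    simp only [Set.mem_iUnion, exists_prop] at hS
    obtain ⟨T, hT, hS⟩ := hS
    obtain ⟨U, hU, hUT⟩ := ih.ancestor T hT
    exact ⟨U, hU, hUT.trans (reflTransGen_isSon_of_mem_mnvbRefine hS)⟩

theorem RefineMNVB.isRefinement {𝒯₀ 𝒯 : Set (Elem d)} (h₀ : IsConforming 𝒯₀)
    (h : RefineMNVB 𝒯₀ 𝒯) : IsRefinement 𝒯₀ 𝒯 :=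
  isRefinement_of_reflTransGen h₀ (Relation.ReflTransGen.mono (fun _ _ => MNVBStep.refineStep) _ _ h)

theorem RefineNVB.isRefinement {𝒯₀ 𝒯 : Set (Elem d)} (h₀ : IsConforming 𝒯₀)
    (h : RefineNVB 𝒯₀ 𝒯) : IsRefinement 𝒯₀ 𝒯 :=
  isRefinement_of_reflTransGen h₀ (Relation.ReflTransGen.mono (fun _ _ => NVBStep.refineStep) _ _ h)

end NVB

/-! ### Area and diameter in terms of the level -/

namespace NVB

variable {d : ℕ}

open Elem

namespace Elem

/-- A measure of size which is halved by bisection. -/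
noncomputable def sizeSq (T : Elem d) : ℝ := ‖T.b - T.a‖ ^ 2 + 4 * ‖T.c - T.mid‖ ^ 2

/-- The Gram determinant of a triangle. -/
noncomputable def gram (T : Elem d) : ℝ :=
  ‖T.b - T.a‖ ^ 2 * ‖T.c - T.a‖ ^ 2 - inner ℝ (T.b - T.a) (T.c - T.a) ^ 2

/-- With `p = (b - a) / 2` and the median `h = c - mid`, the size is `4 (|p|² + |h|²)`. The son has
reference edge `-(p + h)` and median `(p - h) / 2`, so its size is `|p + h|² + |p - h|²`, and the
parallelogram law applies. -/
theorem sizeSq_son₁ (T : Elem d) : T.son₁.sizeSq = T.sizeSq / 2 := by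
  have e₁ : T.son₁.b - T.son₁.a = -((2⁻¹ : ℝ) • (T.b - T.a) + (T.c - T.mid)) := by
    simp only [son₁, mid_eq]; module
  have e₂ : T.son₁.c - T.son₁.mid =
      (2⁻¹ : ℝ) • ((2⁻¹ : ℝ) • (T.b - T.a) - (T.c - T.mid)) := by
    simp only [mid_eq, son₁]; module
  rw [sizeSq, sizeSq, e₁, e₂, norm_neg, norm_smul, mul_pow]
  have := parallelogram_law_with_norm ℝ ((2⁻¹ : ℝ) • (T.b - T.a)) (T.c - T.mid)
  rw [norm_smul] at this
  norm_num at this ⊢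
  nlinarith [this]

theorem sizeSq_son₂ (T : Elem d) : T.son₂.sizeSq = T.sizeSq / 2 := by
  have e₁ : T.son₂.b - T.son₂.a = -((2⁻¹ : ℝ) • (T.b - T.a) - (T.c - T.mid)) := by
    simp only [son₂, mid_eq]; module
  have e₂ : T.son₂.c - T.son₂.mid =
      -((2⁻¹ : ℝ) • ((2⁻¹ : ℝ) • (T.b - T.a) + (T.c - T.mid))) := by
    simp only [mid_eq, son₂]; module
  rw [sizeSq, sizeSq, e₁, e₂, norm_neg, norm_neg, norm_smul, mul_pow]
  have := parallelogram_law_with_norm ℝ ((2⁻¹ : ℝ) • (T.b - T.a)) (T.c - T.mid)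
  rw [norm_smul] at this
  norm_num at this ⊢
  nlinarith [this]

/-- The sons under red refinement are half as large as `T`, up to orientation. -/
theorem red_vectors {T S : Elem d} (hS : S ∈ T.red) : S.gen = T.gen + 2 ∧ ∃ ε : ℝ,
    ε ^ 2 = 4⁻¹ ∧ S.b - S.a = ε • (T.b - T.a) ∧ S.c - S.a = ε • (T.c - T.a) := by
  rcases hS with rfl | rfl | rfl | rfl <;> refine ⟨rfl, ?_⟩
  iterate 3
    refine ⟨2⁻¹, by norm_num, ?_, ?_⟩ <;>
    · simp only [midpoint_eq_smul_add, invOf_eq_inv]; module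
  refine ⟨-2⁻¹, by norm_num, ?_, ?_⟩ <;>
  · simp only [midpoint_eq_smul_add, invOf_eq_inv]; module

theorem c_sub_mid (T : Elem d) : T.c - T.mid = (T.c - T.a) - (2⁻¹ : ℝ) • (T.b - T.a) := by
  rw [mid_eq]; module

theorem sizeSq_red {T S : Elem d} (hS : S ∈ T.red) : S.sizeSq = T.sizeSq / 4 := by
  obtain ⟨-, ε, hε, h₁, h₂⟩ := red_vectors hS
  have h₃ : S.c - S.mid = ε • (T.c - T.mid) := by
    rw [c_sub_mid, c_sub_mid, h₁, h₂]; module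
  rw [sizeSq, sizeSq, h₁, h₃, norm_smul, norm_smul, mul_pow, mul_pow, Real.norm_eq_abs, sq_abs, hε]
  ring

/-- The edge vectors of the son arise from those of `T` by a matrix of determinant `1 / 2`, which
enters the Gram determinant squared. -/
theorem gram_son₁ (T : Elem d) : T.son₁.gram = T.gram / 4 := by
  have e₁ : T.son₁.b - T.son₁.a = -(T.c - T.a) := by simp only [son₁]; module
  have e₂ : T.son₁.c - T.son₁.a = (2⁻¹ : ℝ) • (T.b - T.a) - (T.c - T.a) := by
    simp only [son₁, mid_eq]; module
  rw [gram, gram, e₁, e₂]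
  generalize T.b - T.a = u
  generalize T.c - T.a = w
  simp only [← real_inner_self_eq_norm_sq, inner_sub_left, inner_sub_right, inner_neg_left,
    inner_neg_right, real_inner_smul_left, real_inner_smul_right, real_inner_comm u w]
  ring

theorem gram_son₂ (T : Elem d) : T.son₂.gram = T.gram / 4 := by
  have e₁ : T.son₂.b - T.son₂.a = (T.c - T.a) - (T.b - T.a) := by simp only [son₂]; module
  have e₂ : T.son₂.c - T.son₂.a = -((2⁻¹ : ℝ) • (T.b - T.a)) := by
    simp only [son₂, mid_eq]; module
  rw [gram, gram, e₁, e₂]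
  generalize T.b - T.a = u
  generalize T.c - T.a = w
  simp only [← real_inner_self_eq_norm_sq, inner_sub_left, inner_sub_right, inner_neg_left,
    inner_neg_right, real_inner_smul_left, real_inner_smul_right, real_inner_comm u w]
  ring

theorem gram_red {T S : Elem d} (hS : S ∈ T.red) : S.gram = T.gram / 16 := by
  obtain ⟨-, ε, hε, h₁, h₂⟩ := red_vectors hS
  rw [gram, gram, h₁, h₂, norm_smul, norm_smul, mul_pow, mul_pow, Real.norm_eq_abs, sq_abs,
    real_inner_smul_left, real_inner_smul_right]
  have : ∀ x : ℝ, (ε * (ε * x)) ^ 2 = (ε ^ 2) ^ 2 * x ^ 2 := fun x => by ring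
  rw [this, hε]
  ring

theorem gram_pos {T : Elem d} (h : T.Nondegenerate) : 0 < T.gram := by
  rw [nondegenerate_iff] at h
  set u := T.b - T.a with hu
  set w := T.c - T.a with hw
  have hu0 : u ≠ 0 := by
    intro e
    have := h 1 0 (by simp [e])
    simp at this
  have hu2 : 0 < ‖u‖ ^ 2 := by positivity
  -- This vector is `‖u‖ ^ 2` times the component of `w` orthogonal to `u`; its squared norm is `‖u‖
  -- ^ 2` times the Gram determinant.
  have hv : (0 : ℝ) < ‖(-inner ℝ u w) • u + (‖u‖ ^ 2) • w‖ ^ 2 := by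
    have : (-inner ℝ u w) • u + (‖u‖ ^ 2) • w ≠ 0 := fun e => hu2.ne' (h _ _ e).2
    positivity
  have e : ‖(-inner ℝ u w) • u + (‖u‖ ^ 2) • w‖ ^ 2 = ‖u‖ ^ 2 * T.gram := by
    rw [gram, ← hu, ← hw]
    simp only [← real_inner_self_eq_norm_sq, inner_add_left, inner_add_right,
      real_inner_smul_left, real_inner_smul_right, real_inner_comm u w]
    ring
  rw [e] at hv
  exact pos_of_mul_pos_right hv hu2.le

/-- The linear part of the affine map from the standard triangle to `T`. -/
noncomputable def linMap (T : Elem d) : EuclideanSpace ℝ (Fin 2) →ₗ[ℝ] Point d :=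
  (EuclideanSpace.basisFun (Fin 2) ℝ).toBasis.constr ℝ ![T.b - T.a, T.c - T.a]

theorem linMap_apply (T : Elem d) (x : EuclideanSpace ℝ (Fin 2)) :
    T.linMap x = x 0 • (T.b - T.a) + x 1 • (T.c - T.a) := by
  rw [linMap, Module.Basis.constr_apply_fintype]
  simp [Fin.sum_univ_two]

theorem normDet_linMap_sq (T : Elem d) : T.linMap.normDet ^ 2 = T.gram := by
  have := T.linMap.normDet_sq_eq_det_gram (EuclideanSpace.basisFun (Fin 2) ℝ)
  rw [Matrix.det_fin_two] at this
  simp [Matrix.gram, linMap_apply] at this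
  rw [this, gram, real_inner_comm (T.c - T.a) (T.b - T.a)]
  ring

end Elem

/-- The standard triangle in the Euclidean plane. -/
def stdTriangle : Set (EuclideanSpace ℝ (Fin 2)) := {x | 0 ≤ x 0 ∧ 0 ≤ x 1 ∧ x 0 + x 1 ≤ 1}

/-- The exact volume is never needed: it suffices that it is positive and at most `1`. -/
theorem volume_stdTriangle_le : volume stdTriangle ≤ 1 := by
  have hsub : stdTriangle ⊆ WithLp.ofLp ⁻¹'
      (Set.Icc (fun _ => (0 : ℝ)) (fun _ => 1) : Set (Fin 2 → ℝ)) := by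
    rintro x ⟨h0, h1, h2⟩
    refine ⟨fun i => ?_, fun i => ?_⟩ <;> fin_cases i <;> simp <;> linarith
  refine (measure_mono hsub).trans ?_
  rw [(PiLp.volume_preserving_ofLp (Fin 2)).measure_preimage measurableSet_Icc.nullMeasurableSet]
  simp [Real.volume_Icc_pi]

theorem volume_stdTriangle_pos : 0 < volume stdTriangle := by
  have ho : IsOpen {x : EuclideanSpace ℝ (Fin 2) | 0 < x 0 ∧ 0 < x 1 ∧ x 0 + x 1 < 1} := by
    simp only [Set.ofPred_and]
    exact (isOpen_lt (by fun_prop) (by fun_prop)).inter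
      ((isOpen_lt (by fun_prop) (by fun_prop)).inter (isOpen_lt (by fun_prop) (by fun_prop)))
  refine (ho.measure_pos volume ⟨!₂[1 / 3, 1 / 3], ?_⟩).trans_le (measure_mono ?_)
  · norm_num
  · rintro x ⟨h0, h1, h2⟩
    exact ⟨h0.le, h1.le, h2.le⟩

namespace Elem

theorem carrier_eq_image (T : Elem d) :
    T.carrier = (fun x => T.a + x) '' (T.linMap '' stdTriangle) := by
  ext x
  rw [mem_carrier_iff, Set.image_image]
  constructor
  · rintro ⟨_, ⟨s, t, r, hs, ht, hr, h1, rfl⟩, rfl⟩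
    refine ⟨!₂[t, r], ⟨by simpa, by simpa, by simp; linarith⟩, ?_⟩
    obtain rfl : s = 1 - t - r := by linarith
    simp only [linMap_apply, toPoint_bary]
    simp
    module
  · rintro ⟨y, ⟨h0, h1, h2⟩, rfl⟩
    refine ⟨_, ⟨1 - y 0 - y 1, y 0, y 1, by linarith, h0, h1, by ring, rfl⟩, ?_⟩
    simp only [linMap_apply, toPoint_bary]
    module

/-- The triangle is a translate of a linear image of the standard triangle, and a linear map scales
two-dimensional Hausdorff measure by the root of its Gram determinant, in any ambient dimension. -/
theorem area_eq (T : Elem d) : T.area = (volume stdTriangle).toReal * Real.sqrt T.gram := by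
  have h2 : (μHE[2] : Measure (Point d)) = μHE[Module.finrank ℝ (EuclideanSpace ℝ (Fin 2))] := by
    simp
  rw [area, carrier_eq_image, (isometry_add_left T.a).euclideanHausdorffMeasure_image, h2,
    T.linMap.euclideanHausdorffMeasure_image_eq_normDet_mul_volume, ENNReal.toReal_mul,
    ENNReal.toReal_ofReal (LinearMap.normDet_nonneg _), ← normDet_linMap_sq,
    Real.sqrt_sq (LinearMap.normDet_nonneg _), mul_comm]

theorem isBounded_carrier (T : Elem d) : Bornology.IsBounded T.carrier :=
  isBounded_convexHull.2 (Set.Finite.isBounded (by simp [nodes]))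

theorem area_le_diam_sq (T : Elem d) : T.area ≤ T.diam ^ 2 := by
  have hu : ‖T.b - T.a‖ ≤ T.diam := by
    rw [← dist_eq_norm]
    exact Metric.dist_le_diam_of_mem T.isBounded_carrier T.b_mem_carrier T.a_mem_carrier
  have hw : ‖T.c - T.a‖ ≤ T.diam := by
    rw [← dist_eq_norm]
    exact Metric.dist_le_diam_of_mem T.isBounded_carrier T.c_mem_carrier T.a_mem_carrier
  have hd : 0 ≤ T.diam := Metric.diam_nonneg
  have hv : (volume stdTriangle).toReal ≤ 1 :=
    ENNReal.toReal_le_of_le_ofReal zero_le_one (by simpa using volume_stdTriangle_le)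
  have hg : Real.sqrt T.gram ≤ T.diam ^ 2 := by
    refine Real.sqrt_le_iff.2 ⟨by positivity, ?_⟩
    calc T.gram ≤ ‖T.b - T.a‖ ^ 2 * ‖T.c - T.a‖ ^ 2 := by
          rw [gram]; linarith [sq_nonneg (inner ℝ (T.b - T.a) (T.c - T.a))]
      _ ≤ T.diam ^ 2 * T.diam ^ 2 := by gcongr
      _ = (T.diam ^ 2) ^ 2 := by ring
  rw [area_eq]
  calc _ ≤ 1 * Real.sqrt T.gram := by gcongr
    _ ≤ T.diam ^ 2 := by rwa [one_mul]

theorem area_pos {T : Elem d} (h : T.Nondegenerate) : 0 < T.area := by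
  rw [area_eq]
  refine mul_pos (ENNReal.toReal_pos volume_stdTriangle_pos.ne' ?_) (Real.sqrt_pos.2 (gram_pos h))
  exact (volume_stdTriangle_le.trans_lt ENNReal.one_lt_top).ne

theorem diam_le_sqrt_sizeSq (T : Elem d) : T.diam ≤ Real.sqrt T.sizeSq := by
  have hu : ‖T.b - T.a‖ ≤ Real.sqrt T.sizeSq := by
    apply Real.le_sqrt_of_sq_le
    rw [sizeSq]; nlinarith [sq_nonneg ‖T.c - T.mid‖]
  have hh : ‖T.c - T.mid‖ ≤ Real.sqrt T.sizeSq / 2 := by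
    rw [le_div_iff₀ two_pos]
    apply Real.le_sqrt_of_sq_le
    rw [sizeSq]; nlinarith [sq_nonneg ‖T.b - T.a‖]
  have e₁ : T.c - T.a = (T.c - T.mid) + (2⁻¹ : ℝ) • (T.b - T.a) := by rw [mid_eq]; module
  have e₂ : T.c - T.b = (T.c - T.mid) - (2⁻¹ : ℝ) • (T.b - T.a) := by rw [mid_eq]; module
  have hn : ‖(2⁻¹ : ℝ) • (T.b - T.a)‖ ≤ Real.sqrt T.sizeSq / 2 := by
    rw [norm_smul]; norm_num; linarith
  have hca : ‖T.c - T.a‖ ≤ Real.sqrt T.sizeSq := by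
    rw [e₁]; exact (norm_add_le _ _).trans (by linarith)
  have hcb : ‖T.c - T.b‖ ≤ Real.sqrt T.sizeSq := by
    rw [e₂]; exact (norm_sub_le _ _).trans (by linarith)
  have h0 := Real.sqrt_nonneg T.sizeSq
  rw [diam, carrier, convexHull_diam]
  refine Metric.diam_le_of_forall_dist_le h0 ?_
  rintro x (rfl | rfl | rfl) y (rfl | rfl | rfl) <;>
    first
    | (rw [dist_self]; exact h0)
    | (rw [dist_eq_norm]; assumption)
    | (rw [dist_comm, dist_eq_norm]; assumption)

theorem sizeSq_mul_two_pow {T S : Elem d} (h : Relation.ReflTransGen IsSon T S) :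
    S.sizeSq * 2 ^ S.gen = T.sizeSq * 2 ^ T.gen := by
  refine of_reflTransGen_isSon (P := fun S => S.sizeSq * 2 ^ S.gen = T.sizeSq * 2 ^ T.gen)
    (fun U hU => ?_) (fun U hU => ?_) (fun U hU S hS => ?_) rfl h
  · rw [← hU, sizeSq_son₁, son₁, pow_succ]; ring
  · rw [← hU, sizeSq_son₂, son₂, pow_succ]; ring
  · rw [← hU, sizeSq_red hS, (red_vectors hS).1, pow_add]; ring

theorem gram_mul_four_pow {T S : Elem d} (h : Relation.ReflTransGen IsSon T S) :
    S.gram * 4 ^ S.gen = T.gram * 4 ^ T.gen := by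
  refine of_reflTransGen_isSon (P := fun S => S.gram * 4 ^ S.gen = T.gram * 4 ^ T.gen)
    (fun U hU => ?_) (fun U hU => ?_) (fun U hU S hS => ?_) rfl h
  · rw [← hU, gram_son₁, son₁, pow_succ]; ring
  · rw [← hU, gram_son₂, son₂, pow_succ]; ring
  · rw [← hU, gram_red hS, (red_vectors hS).1, pow_add]; ring

theorem area_mul_two_pow {T S : Elem d} (h : Relation.ReflTransGen IsSon T S) :
    S.area * 2 ^ S.gen = T.area * 2 ^ T.gen := by
  have key : ∀ U : Elem d,
      U.area * 2 ^ U.gen = (volume stdTriangle).toReal * Real.sqrt (U.gram * 4 ^ U.gen) := by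
    intro U
    have : (4 : ℝ) ^ U.gen = (2 ^ U.gen) ^ 2 := by rw [← pow_mul, mul_comm, pow_mul]; norm_num
    rw [area_eq, this, Real.sqrt_mul' _ (by positivity), Real.sqrt_sq (by positivity), mul_assoc]
  rw [key, key, gram_mul_four_pow h]

end Elem

theorem exists_pos_le_of_finite {α : Type*} {s : Set α} (hs : s.Finite) {f : α → ℝ}
    (hf : ∀ x ∈ s, 0 < f x) : ∃ c > 0, ∀ x ∈ s, c ≤ f x := by
  obtain ⟨B, hB⟩ := (hs.image fun x => (f x)⁻¹).bddAbove
  -- The maximum with `1` keeps the constant positive even if `s` is empty.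
  refine ⟨(max B 1)⁻¹, by positivity, fun x hx => ?_⟩
  rw [inv_le_comm₀ (by positivity) (hf x hx)]
  exact (hB ⟨x, hx, rfl⟩).trans (le_max_left _ _)

/-- The mesh sizes of a family of refinements of `𝒯₀` are determined by the levels. -/
theorem exists_size_bounds {Ω : Set (Point d)} {𝒯₀ : Set (Elem d)} (h₀ : IsMeshOn Ω 𝒯₀)
    (hgen : ∀ T ∈ 𝒯₀, T.gen = 0) {A : Set (Elem d) → Prop}
    (hA : ∀ 𝒯, A 𝒯 → IsRefinement 𝒯₀ 𝒯) :
    ∃ c > (0 : ℝ), ∃ C > (0 : ℝ), ∀ 𝒯, A 𝒯 → ∀ T ∈ 𝒯,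
      c * (2 : ℝ) ^ (-(T.gen : ℝ) / 2) ≤ Real.sqrt T.area ∧
      Real.sqrt T.area ≤ T.diam ∧
      T.diam ≤ C * (2 : ℝ) ^ (-(T.gen : ℝ) / 2) := by
  obtain ⟨c, hc, hcle⟩ := exists_pos_le_of_finite h₀.finite (f := fun S => Real.sqrt S.area)
    fun S hS => Real.sqrt_pos.2 (area_pos (h₀.nondegenerate S hS))
  obtain ⟨C, hC⟩ := (h₀.finite.image fun S => Real.sqrt S.sizeSq).bddAbove
  refine ⟨c, hc, max C 1, by positivity, fun 𝒯 h𝒯 T hT => ?_⟩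
  obtain ⟨S, hS, hST⟩ := (hA 𝒯 h𝒯).ancestor T hT
  set r : ℝ := (2 : ℝ) ^ (-(T.gen : ℝ) / 2) with hr
  have hr0 : 0 < r := by positivity
  have hr1 : r ^ 2 * 2 ^ T.gen = 1 := by
    rw [hr, ← Real.rpow_natCast _ 2, ← Real.rpow_mul zero_le_two, ← Real.rpow_natCast _ T.gen,
      ← Real.rpow_add two_pos]
    norm_num
  -- The ancestor has level `0`, so the scaling laws say that area and `sizeSq` of `T` are exactly
  -- `r ^ 2` times those of `S`.
  have key : ∀ x y : ℝ, x * 2 ^ T.gen = y * 2 ^ S.gen → x = y * r ^ 2 := by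
    intro x y e
    rw [hgen S hS, pow_zero, mul_one] at e
    rw [← e, mul_assoc, mul_comm (2 ^ T.gen), hr1, mul_one]
  have harea := key _ _ (area_mul_two_pow hST)
  have hsize := key _ _ (sizeSq_mul_two_pow hST)
  refine ⟨?_, ?_, ?_⟩
  · rw [harea, Real.sqrt_mul' _ (by positivity), Real.sqrt_sq hr0.le]
    gcongr
    exact hcle S hS
  · exact Real.sqrt_le_iff.2 ⟨Metric.diam_nonneg, T.area_le_diam_sq⟩
  · refine T.diam_le_sqrt_sizeSq.trans ?_
    rw [hsize, Real.sqrt_mul' _ (by positivity), Real.sqrt_sq hr0.le]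
    gcongr
    exact (hC ⟨S, hS, rfl⟩).trans (le_max_left _ _)

end NVB

/-! ### Edge levels and the isosceles right metric -/

namespace NVB

variable {d : ℕ}

open Elem

namespace Elem

open Classical in
/-- The level of an edge `E` of `T`: the level of the element which is bisected at `E`. -/
noncomputable def edgeLevel (T : Elem d) (E : Edge d) : ℕ :=
  if E = T.refEdge then T.gen else T.gen + 1

theorem edgeLevel_refEdge (T : Elem d) : T.edgeLevel T.refEdge = T.gen := if_pos rfl

theorem edgeLevel_of_ne {T : Elem d} {E : Edge d} (h : T.refEdge ≠ E) :
    T.edgeLevel E = T.gen + 1 := if_neg h.symm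

theorem gen_le_edgeLevel (T : Elem d) (E : Edge d) : T.gen ≤ T.edgeLevel E := by
  unfold edgeLevel; split_ifs <;> omega

theorem edgeLevel_le (T : Elem d) (E : Edge d) : T.edgeLevel E ≤ T.gen + 1 := by
  unfold edgeLevel; split_ifs <;> omega

theorem edgeLevel_eq_gen_iff {T : Elem d} {E : Edge d} :
    T.edgeLevel E = T.gen ↔ T.refEdge = E := by
  unfold edgeLevel; split_ifs with h
  · simp [h]
  · simp [Ne.symm h]

end Elem

/-- The quadratic form of a scalar product given by two linear functionals. -/
def planeForm (α β : Point d →ₗ[ℝ] ℝ) (v : Point d) : ℝ := 4 * α v ^ 2 + β v ^ 2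

theorem planeForm_smul (α β : Point d →ₗ[ℝ] ℝ) (t : ℝ) (v : Point d) :
    planeForm α β (t • v) = t ^ 2 * planeForm α β v := by
  simp only [planeForm, map_smul, smul_eq_mul]; ring

theorem planeForm_neg (α β : Point d →ₗ[ℝ] ℝ) (v : Point d) :
    planeForm α β (-v) = planeForm α β v := by
  simp [planeForm]

/-- With respect to the scalar product, `T` is an isosceles right triangle whose hypotenuse is its
reference edge and whose size is given by its level. -/
structure IsRightIsosceles (α β : Point d →ₗ[ℝ] ℝ) (T : Elem d) : Prop where
  orth : 4 * (α (T.b - T.a) * α (T.c - T.mid)) + β (T.b - T.a) * β (T.c - T.mid) = 0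
  base : planeForm α β (T.b - T.a) = 4 * (1 / 2) ^ T.gen
  height : planeForm α β (T.c - T.mid) = (1 / 2) ^ T.gen

namespace IsRightIsosceles

variable {α β : Point d →ₗ[ℝ] ℝ} {T : Elem d}

/-- Half the hypotenuse `p` and the median `h` are orthogonal of equal length; so are `p + h` and `p
- h`, which up to scaling are hypotenuse and median of the son. -/
theorem son₁ (h : IsRightIsosceles α β T) : IsRightIsosceles α β T.son₁ := by
  have e₁ : T.son₁.b - T.son₁.a = -((2⁻¹ : ℝ) • (T.b - T.a) + (T.c - T.mid)) := by
    simp only [Elem.son₁, mid_eq]; module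
  have e₂ : T.son₁.c - T.son₁.mid =
      (2⁻¹ : ℝ) • ((2⁻¹ : ℝ) • (T.b - T.a) - (T.c - T.mid)) := by
    simp only [mid_eq, Elem.son₁]; module
  obtain ⟨h1, h2, h3⟩ := h
  unfold planeForm at h2 h3
  constructor <;> simp only [planeForm, e₁, e₂] <;> simp only [map_neg, map_smul, map_add, map_sub,
    smul_eq_mul, Elem.son₁, pow_succ] <;> simp only [map_sub] at h1 h2 h3 <;> linarith

theorem son₂ (h : IsRightIsosceles α β T) : IsRightIsosceles α β T.son₂ := by
  have e₁ : T.son₂.b - T.son₂.a = -((2⁻¹ : ℝ) • (T.b - T.a) - (T.c - T.mid)) := by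
    simp only [Elem.son₂, mid_eq]; module
  have e₂ : T.son₂.c - T.son₂.mid =
      -((2⁻¹ : ℝ) • ((2⁻¹ : ℝ) • (T.b - T.a) + (T.c - T.mid))) := by
    simp only [mid_eq, Elem.son₂]; module
  obtain ⟨h1, h2, h3⟩ := h
  unfold planeForm at h2 h3
  constructor <;> simp only [planeForm, e₁, e₂] <;> simp only [map_neg, map_smul, map_add, map_sub,
    smul_eq_mul, Elem.son₂, pow_succ] <;> simp only [map_sub] at h1 h2 h3 <;> linarith

theorem red (h : IsRightIsosceles α β T) {S : Elem d} (hS : S ∈ T.red) :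
    IsRightIsosceles α β S := by
  obtain ⟨hg, ε, hε, h₁, h₂⟩ := red_vectors hS
  have h₃ : S.c - S.mid = ε • (T.c - T.mid) := by
    rw [c_sub_mid, c_sub_mid, h₁, h₂]; module
  constructor
  · rw [h₁, h₃]
    simp only [map_smul, smul_eq_mul]
    linear_combination ε ^ 2 * h.orth
  · rw [h₁, planeForm_smul, hε, h.base, hg, pow_add]; norm_num; ring
  · rw [h₃, planeForm_smul, hε, h.height, hg, pow_add]; norm_num; ring

theorem of_reflTransGen (h : IsRightIsosceles α β T) {S : Elem d}
    (hS : Relation.ReflTransGen IsSon T S) : IsRightIsosceles α β S :=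
  of_reflTransGen_isSon (fun _ h => h.son₁) (fun _ h => h.son₂) (fun _ h _ hS => h.red hS) h hS

/-- The legs have half the squared length of the hypotenuse, and their edge level is one higher.
Thus the edge level is a function of the length alone, whichever element the edge is viewed from. -/
theorem planeForm_edge (h : IsRightIsosceles α β T) (hT : T.Nondegenerate) {x y : Point d}
    (hxy : s(x, y) ∈ T.edges) :
    planeForm α β (x - y) = 4 * (1 / 2) ^ T.edgeLevel s(x, y) := by
  have hab : planeForm α β (T.b - T.a) = 4 * (1 / 2) ^ T.edgeLevel T.refEdge := by
    rw [edgeLevel_refEdge, h.base]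
  obtain ⟨h1, h2, h3⟩ := h
  unfold planeForm at h2 h3
  have hbc : planeForm α β (T.b - T.c) = 4 * (1 / 2) ^ T.edgeLevel s(T.b, T.c) := by
    have e : T.b - T.c = (2⁻¹ : ℝ) • (T.b - T.a) - (T.c - T.mid) := by rw [mid_eq]; module
    rw [edgeLevel_of_ne (by simp [refEdge, hT.ab, hT.ca.symm]), e, pow_succ]
    simp only [planeForm, map_sub, map_smul, smul_eq_mul] at h1 h2 h3 ⊢
    linarith
  have hca : planeForm α β (T.c - T.a) = 4 * (1 / 2) ^ T.edgeLevel s(T.c, T.a) := by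
    have e : T.c - T.a = (2⁻¹ : ℝ) • (T.b - T.a) + (T.c - T.mid) := by rw [mid_eq]; module
    rw [edgeLevel_of_ne (by simp [refEdge, hT.bc, hT.ca.symm]), e, pow_succ]
    simp only [planeForm, map_sub, map_smul, smul_eq_mul, map_add] at h1 h2 h3 ⊢
    linarith
  have sw : ∀ u v : Point d, planeForm α β (u - v) = planeForm α β (v - u) := by
    intro u v; rw [← planeForm_neg, neg_sub]
  simp only [Elem.edges, Set.mem_insert_iff, Set.mem_singleton_iff] at hxy
  have hsym : ∀ u v : Point d, s(x, y) = s(u, v) →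
      planeForm α β (x - y) = planeForm α β (u - v) := by
    intro u v e
    rcases Sym2.eq_iff.1 e with ⟨rfl, rfl⟩ | ⟨rfl, rfl⟩
    · rfl
    · rw [sw]
  rcases hxy with e | e | e <;> rw [hsym _ _ e, e]
  · rw [sw]; exact hab
  · exact hbc
  · exact hca

end IsRightIsosceles

/-- The functionals `f`, `g` are dual to `u`, `w` on the plane of `T`, by Cramer's rule for the Gram
matrix. Then `f + g / 2` and `g` are the coordinates along `b - a` and along the median `c - mid`.
-/
theorem exists_isRightIsosceles {T : Elem d} (h : T.Nondegenerate) (hg : T.gen = 0) :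
    ∃ α β : Point d →ₗ[ℝ] ℝ, IsRightIsosceles α β T := by
  have hG := (gram_pos h).ne'
  set u := T.b - T.a with hu
  set w := T.c - T.a with hw
  let f : Point d →ₗ[ℝ] ℝ := (T.gram)⁻¹ • ((‖w‖ ^ 2) • innerₛₗ ℝ u - (inner ℝ u w) • innerₛₗ ℝ w)
  let g : Point d →ₗ[ℝ] ℝ := (T.gram)⁻¹ • ((‖u‖ ^ 2) • innerₛₗ ℝ w - (inner ℝ u w) • innerₛₗ ℝ u)
  have hGe : T.gram = ‖u‖ ^ 2 * ‖w‖ ^ 2 - inner ℝ u w ^ 2 := rfl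
  have fu : f u = 1 := by
    simp only [f, LinearMap.smul_apply, LinearMap.sub_apply, innerₛₗ_apply_apply, smul_eq_mul,
      real_inner_self_eq_norm_sq, real_inner_comm u w]
    field_simp; rw [hGe]; ring
  have fw : f w = 0 := by
    simp only [f, LinearMap.smul_apply, LinearMap.sub_apply, innerₛₗ_apply_apply, smul_eq_mul,
      real_inner_self_eq_norm_sq]
    ring
  have gw : g w = 1 := by
    simp only [g, LinearMap.smul_apply, LinearMap.sub_apply, innerₛₗ_apply_apply, smul_eq_mul,
      real_inner_self_eq_norm_sq]
    field_simp; rw [hGe]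
  have gu : g u = 0 := by
    simp only [g, LinearMap.smul_apply, LinearMap.sub_apply, innerₛₗ_apply_apply, smul_eq_mul,
      real_inner_self_eq_norm_sq, real_inner_comm u w]
    ring
  refine ⟨f + (2⁻¹ : ℝ) • g, g, ?_, ?_, ?_⟩ <;>
    simp only [planeForm, c_sub_mid, ← hu, ← hw, LinearMap.add_apply, LinearMap.smul_apply,
      smul_eq_mul, map_sub, map_smul, fu, fw, gu, gw, hg] <;>
    norm_num

/-! ### Consequences of conformity -/

namespace IsConforming

variable {𝒯 : Set (Elem d)}

/-- There are no hanging nodes: the weights of a node of `T'` sit at that node alone, and they are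
its weights in `T` as well. -/
theorem mem_nodes (h : IsConforming 𝒯) {T T' : Elem d} (hT : T ∈ 𝒯) (hT' : T' ∈ 𝒯) {x : Point d}
    (hx : x ∈ T'.nodes) (hxT : x ∈ T.carrier) : x ∈ T.nodes := by
  obtain ⟨μ, hμ, e⟩ := mem_carrier_iff.1 hxT
  have := h.bary_eq T hT T' hT' μ _ hμ (isBary_node hx) (by simp [e])
  exact mem_nodes_of_isBary hμ (by simp [this])

theorem mem_edges_of_subset (h : IsConforming 𝒯) {T : Elem d} (hT : T ∈ 𝒯)
    {E : Edge d} (hE : E ∈ meshEdges 𝒯) (hsub : E.carrier ⊆ T.carrier) : E ∈ T.edges := by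
  obtain ⟨T', hT', hE'⟩ := hE
  induction E using Sym2.ind with | _ u v =>
  rw [Edge.carrier_mk] at hsub
  obtain ⟨hu, hv⟩ := nodes_of_mem_edges hE'
  exact mem_edges_of_nodes (h.mem_nodes hT hT' hu (hsub (left_mem_segment ℝ u v)))
    (h.mem_nodes hT hT' hv (hsub (right_mem_segment ℝ u v)))
    ((h.nondegenerate T' hT').ne_of_mem_edges hE')

/-- `SharesEdge` only requires an edge of the mesh; absence of hanging nodes makes it an edge of
both elements. -/
theorem mem_edges_of_sharesEdge (h : IsConforming 𝒯) {T₁ T₂ : Elem d} {E : Edge d}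
    (hE : SharesEdge 𝒯 T₁ T₂ E) : E ∈ T₁.edges ∧ E ∈ T₂.edges :=
  ⟨h.mem_edges_of_subset hE.1 hE.2.2.1 (hE.2.2.2 ▸ Set.inter_subset_left),
    h.mem_edges_of_subset hE.2.1 hE.2.2.1 (hE.2.2.2 ▸ Set.inter_subset_right)⟩

end IsConforming

theorem Elem.Nondegenerate.not_collinear {T : Elem d} (hT : T.Nondegenerate) {u v : Point d}
    (ha : T.a ∈ segment ℝ u v) (hb : T.b ∈ segment ℝ u v) (hc : T.c ∈ segment ℝ u v) : False := by
  obtain ⟨α₁, β₁, h₁, h₁', hs₁, ha⟩ := ha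
  obtain ⟨α₂, β₂, h₂, h₂', hs₂, hb⟩ := hb
  obtain ⟨α₃, β₃, h₃, h₃', hs₃, hc⟩ := hc
  have ea : T.b - T.a = (β₂ - β₁) • (v - u) := by
    obtain rfl : α₁ = 1 - β₁ := by linarith
    obtain rfl : α₂ = 1 - β₂ := by linarith
    rw [← ha, ← hb]
    module
  have ec : T.c - T.a = (β₃ - β₁) • (v - u) := by
    obtain rfl : α₁ = 1 - β₁ := by linarith
    obtain rfl : α₃ = 1 - β₃ := by linarith
    rw [← ha, ← hc]
    module
  obtain ⟨i1, i2⟩ := (nondegenerate_iff T).1 hT (β₃ - β₁) (-(β₂ - β₁)) (by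
    rw [ea, ec]; module)
  have : T.b - T.a = 0 := by rw [ea, neg_eq_zero.1 i2, zero_smul]
  exact hT.ab (sub_eq_zero.1 this).symm

theorem IsConforming.ne_of_sharesEdge {𝒯 : Set (Elem d)} (h : IsConforming 𝒯) {T₁ T₂ : Elem d}
    {E : Edge d} (hE : SharesEdge 𝒯 T₁ T₂ E) : T₁ ≠ T₂ := by
  rintro rfl
  have hc := hE.2.2.2
  rw [Set.inter_self] at hc
  induction E using Sym2.ind with | _ u v =>
  rw [Edge.carrier_mk] at hc
  exact (h.nondegenerate T₁ hE.1).not_collinear (hc.le T₁.a_mem_carrier) (hc.le T₁.b_mem_carrier)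
    (hc.le T₁.c_mem_carrier)

theorem Elem.edge_carrier_subset {T : Elem d} {E : Edge d} (hE : E ∈ T.edges) :
    E.carrier ⊆ T.carrier := by
  induction E using Sym2.ind with | _ u v =>
  rw [Edge.carrier_mk]
  obtain ⟨hu, hv⟩ := nodes_of_mem_edges hE
  exact (convex_convexHull ℝ _).segment_subset (mem_carrier_of_mem_nodes hu)
    (mem_carrier_of_mem_nodes hv)

/-! ### Comparison of the levels of neighbouring elements -/

section Initial

variable {Ω : Set (Point d)} {𝒯₀ : Set (Elem d)}

/-- Two elements of the initial mesh which both contain a segment share an edge. -/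
theorem IsMeshOn.exists_edge_of_subset (h₀ : IsMeshOn Ω 𝒯₀) {S₁ S₂ : Elem d} (hS₁ : S₁ ∈ 𝒯₀)
    (hS₂ : S₂ ∈ 𝒯₀) (hne : S₁ ≠ S₂) {x y : Point d} (hxy : x ≠ y) (hx₁ : x ∈ S₁.carrier)
    (hx₂ : x ∈ S₂.carrier) (hy₁ : y ∈ S₁.carrier) (hy₂ : y ∈ S₂.carrier) :
    ∃ E ∈ S₁.edges ∩ S₂.edges, S₁.carrier ∩ S₂.carrier = Edge.carrier E := by
  have hx : x ∈ S₁.carrier ∩ S₂.carrier := ⟨hx₁, hx₂⟩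
  have hy : y ∈ S₁.carrier ∩ S₂.carrier := ⟨hy₁, hy₂⟩
  rcases h₀.conforming S₁ hS₁ S₂ hS₂ hne with e | ⟨z, -, e⟩ | h
  · rw [e] at hx; exact hx.elim
  · rw [e] at hx hy
    exact absurd (hx.trans hy.symm) hxy
  · exact h

/-- Both levels are determined by the length of `E` in one and the same metric, that of `S`. -/
theorem edgeLevel_eq_of_same_ancestor {S T₁ T₂ : Elem d} (hS : S.Nondegenerate) (hg : S.gen = 0)
    (h₁ : Relation.ReflTransGen IsSon S T₁) (h₂ : Relation.ReflTransGen IsSon S T₂) {E : Edge d}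
    (hE₁ : E ∈ T₁.edges) (hE₂ : E ∈ T₂.edges) : T₁.edgeLevel E = T₂.edgeLevel E := by
  obtain ⟨α, β, h⟩ := exists_isRightIsosceles hS hg
  induction E using Sym2.ind with | _ x y =>
  have e₁ := (h.of_reflTransGen h₁).planeForm_edge (nondegenerate_of_reflTransGen hS h₁) hE₁
  have e₂ := (h.of_reflTransGen h₂).planeForm_edge (nondegenerate_of_reflTransGen hS h₂) hE₂
  rw [e₁] at e₂
  exact pow_right_injective₀ (a := (1 / 2 : ℝ)) (by norm_num) (by norm_num) (by simpa using e₂)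

/-- The levels of subedges of an edge `E₀` relative to the level of `E₀` depend on the length
only. -/
theorem exists_edge_of_ancestor_ne (h₀ : IsMeshOn Ω 𝒯₀) (hgen : ∀ T ∈ 𝒯₀, T.gen = 0)
    {S₁ S₂ T₁ T₂ : Elem d} (hS₁ : S₁ ∈ 𝒯₀) (hS₂ : S₂ ∈ 𝒯₀) (hne : S₁ ≠ S₂)
    (h₁ : Relation.ReflTransGen IsSon S₁ T₁) (h₂ : Relation.ReflTransGen IsSon S₂ T₂) {E : Edge d}
    (hE₁ : E ∈ T₁.edges) (hE₂ : E ∈ T₂.edges) :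
    ∃ E₀ ∈ S₁.edges ∩ S₂.edges, S₁.carrier ∩ S₂.carrier = Edge.carrier E₀ ∧
      E.carrier ⊆ Edge.carrier E₀ ∧
      T₁.edgeLevel E + S₂.edgeLevel E₀ = T₂.edgeLevel E + S₁.edgeLevel E₀ := by
  have n₁ := h₀.nondegenerate S₁ hS₁
  have n₂ := h₀.nondegenerate S₂ hS₂
  have m₁ := nondegenerate_of_reflTransGen n₁ h₁
  have m₂ := nondegenerate_of_reflTransGen n₂ h₂
  have c₁ := (edge_carrier_subset hE₁).trans (carrier_subset_of_reflTransGen h₁)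
  have c₂ := (edge_carrier_subset hE₂).trans (carrier_subset_of_reflTransGen h₂)
  obtain ⟨α₁, β₁, f₁⟩ := exists_isRightIsosceles n₁ (hgen S₁ hS₁)
  obtain ⟨α₂, β₂, f₂⟩ := exists_isRightIsosceles n₂ (hgen S₂ hS₂)
  induction E using Sym2.ind with | _ x y =>
  have hxy := m₁.ne_of_mem_edges hE₁
  have c₁' := c₁
  have c₂' := c₂
  rw [Edge.carrier_mk] at c₁ c₂
  have hx := left_mem_segment ℝ x y
  have hy := right_mem_segment ℝ x y
  obtain ⟨E₀, hE₀, e⟩ := h₀.exists_edge_of_subset hS₁ hS₂ hne hxy (c₁ hx) (c₂ hx) (c₁ hy) (c₂ hy)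
  have hsub : Edge.carrier s(x, y) ⊆ E₀.carrier := by
    rw [← e]; exact Set.subset_inter c₁' c₂'
  refine ⟨E₀, hE₀, e, hsub, ?_⟩
  induction E₀ using Sym2.ind with | _ u v =>
  rw [Edge.carrier_mk, Edge.carrier_mk] at hsub
  obtain ⟨ξ, η, -, -, hs, ex⟩ := hsub hx
  obtain ⟨ξ', η', -, -, hs', ey⟩ := hsub hy
  -- Both metrics see `E` as `|ξ - ξ'|` times `E₀`. This factor drops out on comparing the two
  -- length formulas.
  have exy : x - y = (ξ - ξ') • (u - v) := by
    obtain rfl : η = 1 - ξ := by linarith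
    obtain rfl : η' = 1 - ξ' := by linarith
    rw [← ex, ← ey]
    module
  have hθ : (ξ - ξ') ≠ 0 := by
    intro h0
    rw [h0, zero_smul, sub_eq_zero] at exy
    exact hxy exy
  have g₁ := (f₁.of_reflTransGen h₁).planeForm_edge m₁ hE₁
  have g₂ := (f₂.of_reflTransGen h₂).planeForm_edge m₂ hE₂
  rw [exy, planeForm_smul, f₁.planeForm_edge n₁ hE₀.1] at g₁
  rw [exy, planeForm_smul, f₂.planeForm_edge n₂ hE₀.2] at g₂
  apply pow_right_injective₀ (a := (1 / 2 : ℝ)) (by norm_num) (by norm_num)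
  simp only [pow_add]
  generalize (1 / 2 : ℝ) ^ T₁.edgeLevel s(x, y) = A at *
  generalize (1 / 2 : ℝ) ^ T₂.edgeLevel s(x, y) = B at *
  generalize (1 / 2 : ℝ) ^ S₁.edgeLevel s(u, v) = C at *
  generalize (1 / 2 : ℝ) ^ S₂.edgeLevel s(u, v) = D at *
  have hA : A = (ξ - ξ') ^ 2 * C := by linarith
  have hB : B = (ξ - ξ') ^ 2 * D := by linarith
  rw [hA, hB]; ring

variable (h₀ : IsMeshOn Ω 𝒯₀) (hgen : ∀ T ∈ 𝒯₀, T.gen = 0) {𝒯 : Set (Elem d)}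
  (h : IsRefinement 𝒯₀ 𝒯)
include h₀ hgen h

/-- Either the levels of a common edge agree or it lies on a common edge of the initial mesh, and
the levels differ by at most one. -/
theorem IsRefinement.edgeLevel_eq_or {T₁ T₂ : Elem d} (hT₁ : T₁ ∈ 𝒯) (hT₂ : T₂ ∈ 𝒯) {E : Edge d}
    (hE₁ : E ∈ T₁.edges) (hE₂ : E ∈ T₂.edges) :
    T₁.edgeLevel E = T₂.edgeLevel E ∨
      (∃ E₀ ∈ meshEdges 𝒯₀, E.carrier ⊆ Edge.carrier E₀) ∧
      T₁.edgeLevel E ≤ T₂.edgeLevel E + 1 ∧ T₂.edgeLevel E ≤ T₁.edgeLevel E + 1 := by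
  obtain ⟨S₁, hS₁, h₁⟩ := h.ancestor T₁ hT₁
  obtain ⟨S₂, hS₂, h₂⟩ := h.ancestor T₂ hT₂
  by_cases hne : S₁ = S₂
  · subst hne
    exact .inl (edgeLevel_eq_of_same_ancestor (h₀.nondegenerate S₁ hS₁) (hgen S₁ hS₁) h₁ h₂ hE₁ hE₂)
  · obtain ⟨E₀, hE₀, -, hsub, e⟩ := exists_edge_of_ancestor_ne h₀ hgen hS₁ hS₂ hne h₁ h₂ hE₁ hE₂
    refine .inr ⟨⟨E₀, ⟨S₁, hS₁, hE₀.1⟩, hsub⟩, ?_⟩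
    have := S₁.edgeLevel_le E₀
    have := S₂.edgeLevel_le E₀
    have := hgen S₁ hS₁
    have := hgen S₂ hS₂
    omega

/-- One unit of the difference comes from the edge levels, and one from the gap between edge level
and `gen`. -/
theorem IsRefinement.abs_gen_sub_le {T₁ T₂ : Elem d} {E : Edge d} (hE : SharesEdge 𝒯 T₁ T₂ E) :
    |(T₁.gen : ℤ) - (T₂.gen : ℤ)| ≤ 2 := by
  obtain ⟨hE₁, hE₂⟩ := h.isConforming.mem_edges_of_sharesEdge hE
  have i := h.edgeLevel_eq_or h₀ hgen hE.1 hE.2.1 hE₁ hE₂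
  have := T₁.gen_le_edgeLevel E
  have := T₂.gen_le_edgeLevel E
  have := T₁.edgeLevel_le E
  have := T₂.edgeLevel_le E
  rw [abs_le]
  omega

/-- At its own reference edge `T` has edge level `T.gen`, so that of `T'` is at most `T.gen + 1 ≤
T'.gen`. As it is also at least `T'.gen`, equality holds throughout, and the edge is the reference
edge of `T'`. -/
theorem IsRefinement.refNeighbor_of_gen_lt {T T' : Elem d} (hN : IsRefNeighbor 𝒯 T T')
    (hlt : T.gen < T'.gen) : CompatiblyDivisible 𝒯 T T' ∧ T'.gen = T.gen + 1 := by
  obtain ⟨hE₁, hE₂⟩ := h.isConforming.mem_edges_of_sharesEdge hN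
  have i := h.edgeLevel_eq_or h₀ hgen hN.1 hN.2.1 hE₁ hE₂
  rw [edgeLevel_refEdge] at i
  have := T'.gen_le_edgeLevel T.refEdge
  have h1 : T'.edgeLevel T.refEdge = T'.gen := by omega
  exact ⟨⟨_, hN, .inl ⟨rfl, edgeLevel_eq_gen_iff.1 h1⟩⟩, by omega⟩

omit h₀ hgen h in
theorem SharesEdge.compatiblyDivisible {T₁ T₂ : Elem d} {E : Edge d} (hE : SharesEdge 𝒯 T₁ T₂ E)
    (hg : T₁.gen = T₂.gen) (hl : T₁.edgeLevel E = T₂.edgeLevel E) :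
    CompatiblyDivisible 𝒯 T₁ T₂ := by
  refine ⟨E, hE, ?_⟩
  by_cases h1 : T₁.refEdge = E
  · exact .inl ⟨h1, edgeLevel_eq_gen_iff.1 (by rw [← hl, edgeLevel_eq_gen_iff.2 h1, hg])⟩
  · exact .inr ⟨h1, fun h2 =>
      h1 (edgeLevel_eq_gen_iff.1 (by rw [hl, edgeLevel_eq_gen_iff.2 h2, hg]))⟩

theorem IsRefinement.compatiblyDivisible_of_same_ancestor {S : Elem d} (hS : S ∈ 𝒯₀)
    {T₁ T₂ : Elem d} {E : Edge d} (h₁ : IsSuccessor S T₁) (h₂ : IsSuccessor S T₂)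
    (hE : SharesEdge 𝒯 T₁ T₂ E) (hg : T₁.gen = T₂.gen) : CompatiblyDivisible 𝒯 T₁ T₂ := by
  obtain ⟨hE₁, hE₂⟩ := h.isConforming.mem_edges_of_sharesEdge hE
  exact hE.compatiblyDivisible hg (edgeLevel_eq_of_same_ancestor (h₀.nondegenerate S hS)
    (hgen S hS) h₁.reflTransGen h₂.reflTransGen hE₁ hE₂)

theorem IsRefinement.compatiblyDivisible_of_ancestors {S₁ S₂ : Elem d}
    (hS : CompatiblyDivisible 𝒯₀ S₁ S₂) {T₁ T₂ : Elem d} {E : Edge d} (h₁ : IsSuccessor S₁ T₁)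
    (h₂ : IsSuccessor S₂ T₂) (hE : SharesEdge 𝒯 T₁ T₂ E) (hg : T₁.gen = T₂.gen) :
    CompatiblyDivisible 𝒯 T₁ T₂ := by
  obtain ⟨E₁, hE₁, hc⟩ := hS
  have hconf := h₀.isConforming
  obtain ⟨hT₁, hT₂⟩ := h.isConforming.mem_edges_of_sharesEdge hE
  obtain ⟨E₀, hE₀, e, -, el⟩ := exists_edge_of_ancestor_ne h₀ hgen hE₁.1 hE₁.2.1
    (hconf.ne_of_sharesEdge hE₁) h₁.reflTransGen h₂.reflTransGen hT₁ hT₂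
  have hE₁' := (hconf.mem_edges_of_sharesEdge hE₁).1
  -- Both edges stand for the same segment `S₁ ∩ S₂`, and an edge of a triangle contains no nodes
  -- other than its end points. Compatibility of `S₁`, `S₂` then makes the levels of `E₀` equal.
  have hEE : E₀ = E₁ := by
    have hcar : Edge.carrier E₀ = Edge.carrier E₁ := e.symm.trans hE₁.2.2.2
    have nd := h₀.nondegenerate S₁ hE₁.1
    have hE₀' := hE₀.1
    clear el e hE₀
    induction E₀ using Sym2.ind with | _ u v =>
    induction E₁ using Sym2.ind with | _ x y =>
    rw [Edge.carrier_mk, Edge.carrier_mk] at hcar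
    have key : ∀ z ∈ S₁.nodes, z ∈ segment ℝ x y → z = x ∨ z = y := by
      rintro z hz ⟨ξ, η, hξ, hη, h1, ez⟩
      have := nd.bary_unique (isBary_node hz) (isBary_edge hE₁' hξ hη h1) (by simp [ez])
      by_contra! hn
      have h2 := DFunLike.congr_fun this z
      simp [hn.1, hn.2] at h2
    obtain ⟨hu, hv⟩ := nodes_of_mem_edges hE₀'
    have huv := nd.ne_of_mem_edges hE₀'
    have ku := key u hu (hcar ▸ left_mem_segment ℝ u v)
    have kv := key v hv (hcar ▸ right_mem_segment ℝ u v)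
    rw [Sym2.eq_iff]
    grind
  subst hEE
  refine hE.compatiblyDivisible hg ?_
  have hg₁ := hgen S₁ hE₁.1
  have hg₂ := hgen S₂ hE₁.2.1
  rcases hc with ⟨i, j⟩ | ⟨i, j⟩
  · rw [edgeLevel_eq_gen_iff.2 i, edgeLevel_eq_gen_iff.2 j] at el
    omega
  · rw [edgeLevel_of_ne i, edgeLevel_of_ne j] at el
    omega

theorem IsRefinement.refEdge_subset_of_not_compatiblyDivisible {T T' : Elem d}
    (hN : IsRefNeighbor 𝒯 T T') (hg : T'.gen = T.gen) (hc : ¬ CompatiblyDivisible 𝒯 T T') :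
    ∃ E₀ ∈ meshEdges 𝒯₀, T.refEdge.carrier ⊆ Edge.carrier E₀ := by
  obtain ⟨hE₁, hE₂⟩ := h.isConforming.mem_edges_of_sharesEdge hN
  rcases h.edgeLevel_eq_or h₀ hgen hN.1 hN.2.1 hE₁ hE₂ with i | i
  · exact absurd (SharesEdge.compatiblyDivisible hN hg.symm i) hc
  · exact i.1

end Initial

end NVB

/-! ### Elements in a corner and elements with a common edge -/

namespace NVB

variable {d : ℕ}

open Elem

namespace Elem

/-- The triangle `T` with all orders of its nodes. -/
def orders (T : Elem d) : Set (Elem d) :=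
  {⟨T.a, T.b, T.c, T.gen⟩, ⟨T.b, T.a, T.c, T.gen⟩, ⟨T.b, T.c, T.a, T.gen⟩,
    ⟨T.c, T.b, T.a, T.gen⟩, ⟨T.c, T.a, T.b, T.gen⟩, ⟨T.a, T.c, T.b, T.gen⟩}

variable {T T' : Elem d}

theorem isBary_of_mem_orders (h : T' ∈ T.orders) {μ : Point d →₀ ℝ} (hμ : T'.IsBary μ) :
    T.IsBary μ := by
  obtain ⟨s, t, r, hs, ht, hr, h1, rfl⟩ := hμ
  rcases h with rfl | rfl | rfl | rfl | rfl | rfl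
  · exact ⟨s, t, r, hs, ht, hr, by linarith, by simp only [bary]⟩
  · exact ⟨t, s, r, ht, hs, hr, by linarith, by simp only [bary]; abel⟩
  · exact ⟨r, s, t, hr, hs, ht, by linarith, by simp only [bary]; abel⟩
  · exact ⟨r, t, s, hr, ht, hs, by linarith, by simp only [bary]; abel⟩
  · exact ⟨t, r, s, ht, hr, hs, by linarith, by simp only [bary]; abel⟩
  · exact ⟨s, r, t, hs, hr, ht, by linarith, by simp only [bary]; abel⟩

theorem mem_orders_symm (h : T' ∈ T.orders) : T ∈ T'.orders := by
  rcases h with rfl | rfl | rfl | rfl | rfl | rfl <;> simp [orders]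

theorem isPos_of_mem_orders (h : T' ∈ T.orders) {μ : Point d →₀ ℝ} (hμ : T'.IsPos μ) :
    T.IsPos μ := by
  rcases h with rfl | rfl | rfl | rfl | rfl | rfl <;> obtain ⟨h1, h2, h3⟩ := hμ <;>
    exact ⟨by assumption, by assumption, by assumption⟩

theorem Nondegenerate.of_mem_orders (hT : T.Nondegenerate) (h : T' ∈ T.orders) :
    T'.Nondegenerate := by
  rw [nondegenerate_iff]
  intro s t e
  rcases h with rfl | rfl | rfl | rfl | rfl | rfl
  · have := (nondegenerate_iff T).1 hT s t e
    exact this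
  · have := (nondegenerate_iff T).1 hT (-s - t) t (by rw [← e]; module)
    constructor <;> linarith [this.1, this.2]
  · have := (nondegenerate_iff T).1 hT (-s - t) s (by rw [← e]; module)
    constructor <;> linarith [this.1, this.2]
  · have := (nondegenerate_iff T).1 hT s (-s - t) (by rw [← e]; module)
    constructor <;> linarith [this.1, this.2]
  · have := (nondegenerate_iff T).1 hT t (-s - t) (by rw [← e]; module)
    constructor <;> linarith [this.1, this.2]
  · have := (nondegenerate_iff T).1 hT t s (by rw [← e]; module)
    exact this.symm

theorem carrier_of_mem_orders (h : T' ∈ T.orders) : T'.carrier = T.carrier := by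
  ext x
  rw [mem_carrier_iff, mem_carrier_iff]
  exact ⟨fun ⟨μ, hμ, e⟩ => ⟨μ, isBary_of_mem_orders h hμ, e⟩,
    fun ⟨μ, hμ, e⟩ => ⟨μ, isBary_of_mem_orders (mem_orders_symm h) hμ, e⟩⟩

theorem exists_order_of_edge {x y : Point d} (h : s(x, y) ∈ T.edges) :
    ∃ T' ∈ T.orders, T'.a = x ∧ T'.b = y := by
  simp only [edges, Set.mem_insert_iff, Set.mem_singleton_iff, Sym2.eq_iff] at h
  rcases h with (⟨rfl, rfl⟩ | ⟨rfl, rfl⟩) | (⟨rfl, rfl⟩ | ⟨rfl, rfl⟩) | (⟨rfl, rfl⟩ | ⟨rfl, rfl⟩)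
  · exact ⟨⟨T.a, T.b, T.c, T.gen⟩, by simp [orders], rfl, rfl⟩
  · exact ⟨⟨T.b, T.a, T.c, T.gen⟩, by simp [orders], rfl, rfl⟩
  · exact ⟨⟨T.b, T.c, T.a, T.gen⟩, by simp [orders], rfl, rfl⟩
  · exact ⟨⟨T.c, T.b, T.a, T.gen⟩, by simp [orders], rfl, rfl⟩
  · exact ⟨⟨T.c, T.a, T.b, T.gen⟩, by simp [orders], rfl, rfl⟩
  · exact ⟨⟨T.a, T.c, T.b, T.gen⟩, by simp [orders], rfl, rfl⟩

theorem exists_order_of_edges {E₁ E₂ : Edge d} (h₁ : E₁ ∈ T.edges) (h₂ : E₂ ∈ T.edges)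
    (hne : E₁ ≠ E₂) : ∃ T' ∈ T.orders, E₁ = s(T'.a, T'.b) ∧ E₂ = s(T'.a, T'.c) := by
  rcases h₁ with rfl | rfl | rfl <;> rcases h₂ with rfl | rfl | rfl
  · exact absurd rfl hne
  · exact ⟨⟨T.b, T.a, T.c, T.gen⟩, by simp [orders], Sym2.eq_swap, rfl⟩
  · exact ⟨⟨T.a, T.b, T.c, T.gen⟩, by simp [orders], rfl, Sym2.eq_swap⟩
  · exact ⟨⟨T.b, T.c, T.a, T.gen⟩, by simp [orders], rfl, Sym2.eq_swap⟩
  · exact absurd rfl hne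
  · exact ⟨⟨T.c, T.b, T.a, T.gen⟩, by simp [orders], Sym2.eq_swap, rfl⟩
  · exact ⟨⟨T.a, T.c, T.b, T.gen⟩, by simp [orders], Sym2.eq_swap, rfl⟩
  · exact ⟨⟨T.c, T.a, T.b, T.gen⟩, by simp [orders], rfl, Sym2.eq_swap⟩
  · exact absurd rfl hne

theorem finite_orders (T : Elem d) : T.orders.Finite := by simp [orders]

/-- `T` has a common corner with `S` at the node `a` of `S`: two of its edges lie on the edges of
`S` at `a`. -/
def IsCorner (S T : Elem d) : Prop := ∃ T' ∈ T.orders, ∃ s > (0 : ℝ), ∃ t > (0 : ℝ),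
  T'.a = S.a ∧ T'.b = S.a + s • (S.b - S.a) ∧ T'.c = S.a + t • (S.c - S.a)

end Elem

namespace IsConforming

variable {𝒯 : Set (Elem d)}

/-- An element whose interior meets another element of a conforming mesh is equal to it. -/
theorem eq_of_pos (h : IsConforming 𝒯) {T₁ T₂ T₁' T₂' : Elem d} (hT₁ : T₁ ∈ 𝒯) (hT₂ : T₂ ∈ 𝒯)
    (h₁ : T₁' ∈ T₁.orders) (h₂ : T₂' ∈ T₂.orders) {s t r s' t' r' : ℝ} (hs : 0 < s) (ht : 0 < t)
    (hr : 0 < r) (h1 : s + t + r = 1) (hs' : 0 ≤ s') (ht' : 0 ≤ t') (hr' : 0 ≤ r')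
    (h1' : s' + t' + r' = 1) (e : s • T₁'.a + t • T₁'.b + r • T₁'.c =
      s' • T₂'.a + t' • T₂'.b + r' • T₂'.c) : T₁ = T₂ := by
  have b₁ : T₁'.IsBary (T₁'.bary s t r) := ⟨s, t, r, hs.le, ht.le, hr.le, h1, rfl⟩
  have b₂ : T₂'.IsBary (T₂'.bary s' t' r') := ⟨s', t', r', hs', ht', hr', h1', rfl⟩
  have p₁ : T₁'.IsPos (T₁'.bary s t r) :=
    (isPos_bary ((h.nondegenerate T₁ hT₁).of_mem_orders h₁)).2 ⟨hs, ht, hr⟩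
  have b₁ := isBary_of_mem_orders h₁ b₁
  have b₂ := isBary_of_mem_orders h₂ b₂
  have p₁ := isPos_of_mem_orders h₁ p₁
  have := h.bary_eq T₁ hT₁ T₂ hT₂ _ _ b₁ b₂ (by rw [toPoint_bary, toPoint_bary, e])
  rw [← this] at b₂
  exact h.unique T₁ hT₁ T₂ hT₂ _ p₁ b₁ b₂

/-- Two triangles filling the same corner overlap: for small `ε` the point `S.a + ε (S.b - S.a) + ε
(S.c - S.a)` is interior to both. -/
theorem eq_of_isCorner (h : IsConforming 𝒯) {S T₁ T₂ : Elem d} (hT₁ : T₁ ∈ 𝒯) (hT₂ : T₂ ∈ 𝒯)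
    (h₁ : S.IsCorner T₁) (h₂ : S.IsCorner T₂) : T₁ = T₂ := by
  obtain ⟨T₁', o₁, s, hs, t, ht, ea, eb, ec⟩ := h₁
  obtain ⟨T₂', o₂, s', hs', t', ht', ea', eb', ec'⟩ := h₂
  -- With `ε = K⁻¹ / 2` the weights `ε / s` and `ε / t` add up to at most `1 / 2`, and likewise for
  -- the second triangle.
  set K := 1 + s⁻¹ + t⁻¹ + s'⁻¹ + t'⁻¹ with hK
  have is := inv_pos.2 hs
  have it := inv_pos.2 ht
  have is' := inv_pos.2 hs'
  have it' := inv_pos.2 ht'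
  have hK0 : 0 < K := by positivity
  have bound : ∀ x y : ℝ, x + y ≤ K → K⁻¹ / 2 * x + K⁻¹ / 2 * y ≤ 1 / 2 := by
    intro x y hxy
    have : K⁻¹ * (x + y) ≤ 1 := by rw [inv_mul_le_iff₀ hK0]; linarith
    linarith
  have b₁ := bound s⁻¹ t⁻¹ (by linarith)
  have b₂ := bound s'⁻¹ t'⁻¹ (by linarith)
  have cancel : ∀ x : ℝ, 0 < x → ∀ v : Point d, (K⁻¹ / 2 * x⁻¹) • (x • v) = (K⁻¹ / 2) • v := by
    intro x hx v
    rw [smul_smul, mul_assoc, inv_mul_cancel₀ hx.ne', mul_one]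
  refine h.eq_of_pos hT₁ hT₂ o₁ o₂ (s := 1 - K⁻¹ / 2 * s⁻¹ - K⁻¹ / 2 * t⁻¹) (t := K⁻¹ / 2 * s⁻¹)
    (r := K⁻¹ / 2 * t⁻¹) (s' := 1 - K⁻¹ / 2 * s'⁻¹ - K⁻¹ / 2 * t'⁻¹) (t' := K⁻¹ / 2 * s'⁻¹)
    (r' := K⁻¹ / 2 * t'⁻¹) (by linarith) (by positivity) (by positivity) (by ring) (by linarith)
    (by positivity) (by positivity) (by ring) ?_
  rw [ea, eb, ec, ea', eb', ec', smul_add, smul_add, smul_add, smul_add, cancel s hs, cancel t ht,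
    cancel s' hs', cancel t' ht']
  module

end IsConforming

theorem Elem.exists_coord {S : Elem d} {x : Point d} (hx : x ∈ S.carrier) :
    ∃ s t : ℝ, x = S.a + s • (S.b - S.a) + t • (S.c - S.a) := by
  obtain ⟨_, ⟨s, t, r, -, -, -, h1, rfl⟩, rfl⟩ := mem_carrier_iff.1 hx
  refine ⟨t, r, ?_⟩
  obtain rfl : s = 1 - t - r := by linarith
  rw [toPoint_bary]; module

/-- Three different elements of a conforming mesh in one plane have no common edge. -/
theorem IsConforming.exists_eq_of_common_edge {𝒯 : Set (Elem d)} (h : IsConforming 𝒯)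
    {S T₁ T₂ T₃ : Elem d} (hT₁ : T₁ ∈ 𝒯) (hT₂ : T₂ ∈ 𝒯) (hT₃ : T₃ ∈ 𝒯)
    (h₁ : T₁.carrier ⊆ S.carrier) (h₂ : T₂.carrier ⊆ S.carrier) (h₃ : T₃.carrier ⊆ S.carrier)
    {E : Edge d} (hE₁ : E ∈ T₁.edges) (hE₂ : E ∈ T₂.edges) (hE₃ : E ∈ T₃.edges) :
    T₁ = T₂ ∨ T₁ = T₃ ∨ T₂ = T₃ := by
  induction E using Sym2.ind with | _ x y =>
  set u := S.b - S.a with hu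
  set w := S.c - S.a with hw
  obtain ⟨sx, tx, ex⟩ := exists_coord
    (h₁ (mem_carrier_of_mem_nodes (nodes_of_mem_edges hE₁).1))
  obtain ⟨sy, ty, ey⟩ := exists_coord
    (h₁ (mem_carrier_of_mem_nodes (nodes_of_mem_edges hE₁).2))
  rw [← hu, ← hw] at ex ey
  -- The sign of this determinant tells on which side of the line through `x`, `y` the third node
  -- lies; it is nonzero by nondegeneracy. Two triangles on the same side overlap, which is `side`.
  have key : ∀ T ∈ 𝒯, T.carrier ⊆ S.carrier → s(x, y) ∈ T.edges → ∃ T' ∈ T.orders, T'.a = x ∧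
      T'.b = y ∧ ∃ s t : ℝ, T'.c = S.a + s • u + t • w ∧
        (sy - sx) * (t - tx) - (ty - tx) * (s - sx) ≠ 0 := by
    intro T hT hTS hE
    obtain ⟨T', o, ha, hb⟩ := exists_order_of_edge hE
    have hc : T'.c ∈ S.carrier := hTS (carrier_of_mem_orders o ▸ T'.c_mem_carrier)
    obtain ⟨s, t, e⟩ := exists_coord hc
    rw [← hu, ← hw] at e
    refine ⟨T', o, ha, hb, s, t, e, fun h0 => ?_⟩
    have nd := (nondegenerate_iff T').1 ((h.nondegenerate T hT).of_mem_orders o)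
    have i1 := nd (t - tx) (-(ty - tx)) (by
      rw [ha, hb, e, ex, ey]
      have : (t - tx) • (S.a + sy • u + ty • w - (S.a + sx • u + tx • w)) +
          -(ty - tx) • (S.a + s • u + t • w - (S.a + sx • u + tx • w)) =
          ((sy - sx) * (t - tx) - (ty - tx) * (s - sx)) • u := by module
      rw [this, h0, zero_smul])
    have i2 := nd (-(s - sx)) (sy - sx) (by
      rw [ha, hb, e, ex, ey]
      have : -(s - sx) • (S.a + sy • u + ty • w - (S.a + sx • u + tx • w)) +
          (sy - sx) • (S.a + s • u + t • w - (S.a + sx • u + tx • w)) =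
          ((sy - sx) * (t - tx) - (ty - tx) * (s - sx)) • w := by module
      rw [this, h0, zero_smul])
    have : T'.a = T'.b := by
      rw [ha, hb, ex, ey, sub_eq_zero.1 i2.2, sub_eq_zero.1 (neg_eq_zero.1 i1.2)]
    exact ((h.nondegenerate T hT).of_mem_orders o).ab this
  have side : ∀ T₁ ∈ 𝒯, ∀ T₂ ∈ 𝒯, ∀ T₁' ∈ T₁.orders, ∀ T₂' ∈ T₂.orders, T₁'.a = x → T₁'.b = y →
      T₂'.a = x → T₂'.b = y → ∀ s t s' t' : ℝ, T₁'.c = S.a + s • u + t • w →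
      T₂'.c = S.a + s' • u + t' • w →
      0 < ((sy - sx) * (t - tx) - (ty - tx) * (s - sx)) *
        ((sy - sx) * (t' - tx) - (ty - tx) * (s' - sx)) → T₁ = T₂ := by
    intro T₁ hT₁ T₂ hT₂ T₁' o₁ T₂' o₂ a₁ b₁ a₂ b₂ s t s' t' c₁ c₂ hD
    set D := (sy - sx) * (t - tx) - (ty - tx) * (s - sx) with hD₁
    set D' := (sy - sx) * (t' - tx) - (ty - tx) * (s' - sx) with hD₂
    have hD0 : D' ≠ 0 := fun h0 => by rw [h0, mul_zero] at hD; exact hD.false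
    set B := D / D' with hB
    have hB0 : 0 < B := by
      have : B = D * D' / D' ^ 2 := by rw [hB]; field_simp
      rw [this]; positivity
    set L := ((s - sx) * (t' - tx) - (t - tx) * (s' - sx)) / D' with hL
    -- Cramer's rule; `B` is the quotient of the two determinants, positive on the same side.
    have cram : T₁'.c = x + L • (y - x) + B • (T₂'.c - x) := by
      have i1 : s - sx = L * (sy - sx) + B * (s' - sx) := by
        rw [hL, hB]; field_simp; rw [hD₁, hD₂]; ring
      have i2 : t - tx = L * (ty - tx) + B * (t' - tx) := by
        rw [hL, hB]; field_simp; rw [hD₁, hD₂]; ring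
      have e : T₁'.c = x + (s - sx) • u + (t - tx) • w := by rw [c₁, ex]; module
      rw [e, i1, i2, c₂, ey, ex]
      module
    set K := 1 + |L| + B with hK
    have hL0 := abs_nonneg L
    have hK0 : 0 < K := by positivity
    have hKi : 0 < K⁻¹ := inv_pos.2 hK0
    have hKK : K⁻¹ * (1 + |L| + B) = 1 := inv_mul_cancel₀ hK0.ne'
    have p1 : 0 < K⁻¹ * B := by positivity
    have p2 : 0 ≤ K⁻¹ * |L| := by positivity
    have p3 : K⁻¹ * L ≤ K⁻¹ * |L| := by gcongr; exact le_abs_self L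
    have p4 : -(K⁻¹ * |L|) ≤ K⁻¹ * L := by
      rw [← mul_neg]; gcongr; exact neg_abs_le L
    -- The common point is the midpoint of `x`, `y` pushed slightly towards `T₁'.c`; `K` dominates
    -- `|L|` and `B`, so that its weights in the second triangle stay nonnegative.
    refine h.eq_of_pos hT₁ hT₂ o₁ o₂ (s := 1 / 2 - K⁻¹ / 4) (t := 1 / 2) (r := K⁻¹ / 4)
      (s' := 1 / 2 - K⁻¹ / 4 * L - K⁻¹ / 4 * B) (t' := 1 / 2 + K⁻¹ / 4 * L) (r' := K⁻¹ / 4 * B)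
      (by linarith) (by norm_num) (by positivity) (by ring) (by linarith) (by linarith)
      (by positivity) (by ring) ?_
    rw [a₁, b₁, a₂, b₂, cram]
    module
  obtain ⟨T₁', o₁, a₁, b₁, s₁, t₁, c₁, d₁⟩ := key T₁ hT₁ h₁ hE₁
  obtain ⟨T₂', o₂, a₂, b₂, s₂, t₂, c₂, d₂⟩ := key T₂ hT₂ h₂ hE₂
  obtain ⟨T₃', o₃, a₃, b₃, s₃, t₃, c₃, d₃⟩ := key T₃ hT₃ h₃ hE₃
  have k₁₂ := side T₁ hT₁ T₂ hT₂ T₁' o₁ T₂' o₂ a₁ b₁ a₂ b₂ _ _ _ _ c₁ c₂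
  have k₁₃ := side T₁ hT₁ T₃ hT₃ T₁' o₁ T₃' o₃ a₁ b₁ a₃ b₃ _ _ _ _ c₁ c₃
  have k₂₃ := side T₂ hT₂ T₃ hT₃ T₂' o₂ T₃' o₃ a₂ b₂ a₃ b₃ _ _ _ _ c₂ c₃
  -- Of three nonzero determinants, two have the same sign.
  rcases lt_or_gt_of_ne d₁ with f₁ | f₁ <;> rcases lt_or_gt_of_ne d₂ with f₂ | f₂ <;>
    rcases lt_or_gt_of_ne d₃ with f₃ | f₃
  all_goals
    first
    | exact .inl (k₁₂ (mul_pos_of_neg_of_neg f₁ f₂))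
    | exact .inl (k₁₂ (mul_pos f₁ f₂))
    | exact .inr (.inl (k₁₃ (mul_pos_of_neg_of_neg f₁ f₃)))
    | exact .inr (.inl (k₁₃ (mul_pos f₁ f₃)))
    | exact .inr (.inr (k₂₃ (mul_pos_of_neg_of_neg f₂ f₃)))
    | exact .inr (.inr (k₂₃ (mul_pos f₂ f₃)))

/-- A triangle in `S` two edges of which lie on edges of `S` has a common corner with `S`. -/
theorem Elem.exists_isCorner {S T : Elem d} (hS : S.Nondegenerate) (hT : T.Nondegenerate)
    {e₁ e₂ E₁ E₂ : Edge d} (he₁ : e₁ ∈ T.edges) (he₂ : e₂ ∈ T.edges) (hne : e₁ ≠ e₂)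
    (hE₁ : E₁ ∈ S.edges) (hE₂ : E₂ ∈ S.edges) (h₁ : e₁.carrier ⊆ Edge.carrier E₁)
    (h₂ : e₂.carrier ⊆ Edge.carrier E₂) : ∃ S' ∈ S.orders, S'.IsCorner T := by
  obtain ⟨T', oT, rfl, rfl⟩ := exists_order_of_edges he₁ he₂ hne
  have hT' := hT.of_mem_orders oT
  rw [Edge.carrier_mk] at h₁ h₂
  by_cases hEE : E₁ = E₂
  · subst hEE
    induction E₁ using Sym2.ind with | _ u v =>
    rw [Edge.carrier_mk] at h₁ h₂
    exact (hT'.not_collinear (h₁ (left_mem_segment ℝ _ _)) (h₁ (right_mem_segment ℝ _ _))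
      (h₂ (right_mem_segment ℝ _ _))).elim
  obtain ⟨S', oS, rfl, rfl⟩ := exists_order_of_edges hE₁ hE₂ hEE
  have hS' := hS.of_mem_orders oS
  rw [Edge.carrier_mk] at h₁ h₂
  have form : ∀ z v p : Point d, p ∈ segment ℝ z v → ∃ t ≥ (0 : ℝ), p = z + t • (v - z) := by
    rintro z v p ⟨ξ, η, -, hη, h1, rfl⟩
    refine ⟨η, hη, ?_⟩
    obtain rfl : ξ = 1 - η := by linarith
    module
  -- The common node `T'.a` lies on both edges of `S'` at `S'.a`, hence is `S'.a`.
  obtain ⟨t₁, -, f₁⟩ := form _ _ _ (h₁ (left_mem_segment ℝ _ _))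
  obtain ⟨t₂, -, f₂⟩ := form _ _ _ (h₂ (left_mem_segment ℝ _ _))
  obtain ⟨s, hs, fb⟩ := form _ _ _ (h₁ (right_mem_segment ℝ _ _))
  obtain ⟨t, ht, fc⟩ := form _ _ _ (h₂ (right_mem_segment ℝ _ _))
  have i := (nondegenerate_iff S').1 hS' t₁ (-t₂) (by
    have := f₁.symm.trans f₂
    rw [add_right_inj] at this
    rw [this]; module)
  have fa : T'.a = S'.a := by rw [f₁, i.1]; simp
  refine ⟨S', oS, T', oT, s, lt_of_le_of_ne hs ?_, t, lt_of_le_of_ne ht ?_, fa, fb, fc⟩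
  · rintro rfl
    exact hT'.ab (by rw [fa, fb]; simp)
  · rintro rfl
    exact hT'.ca (by rw [fa, fc]; simp)

end NVB

/-! ### Chains of reference neighbours -/

namespace NVB

variable {d : ℕ}

open Elem

section Initial

variable {Ω : Set (Point d)} {𝒯₀ : Set (Elem d)}

/-- `E` lies on an edge of `𝒯`. -/
def LiesOnEdge (𝒯 : Set (Elem d)) (E : Edge d) : Prop :=
  ∃ E₀ ∈ meshEdges 𝒯, E.carrier ⊆ Edge.carrier E₀

theorem IsRefinement.refEdge_eq_or_liesOnEdge (h₀ : IsMeshOn Ω 𝒯₀) (hgen : ∀ T ∈ 𝒯₀, T.gen = 0)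
    {𝒯 : Set (Elem d)} (h : IsRefinement 𝒯₀ 𝒯) {T T' : Elem d} (hN : IsRefNeighbor 𝒯 T T')
    (hg : T.gen = T'.gen) : T'.refEdge = T.refEdge ∨ LiesOnEdge 𝒯₀ T.refEdge := by
  obtain ⟨hE₁, hE₂⟩ := h.isConforming.mem_edges_of_sharesEdge hN
  rcases h.edgeLevel_eq_or h₀ hgen hN.1 hN.2.1 hE₁ hE₂ with i | i
  · rw [edgeLevel_refEdge, hg] at i
    exact .inl (edgeLevel_eq_gen_iff.1 i.symm)
  · exact .inr i.1

/-- The initial edge may belong to another element `S'`. Then `S ∩ S'` contains the segment `E`, so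
it is a common edge of the two. -/
theorem IsMeshOn.exists_edge_of_liesOnEdge (h₀ : IsMeshOn Ω 𝒯₀) {S T : Elem d} (hS : S ∈ 𝒯₀)
    (hT : T.Nondegenerate) (hTS : T.carrier ⊆ S.carrier) {E : Edge d} (hE : E ∈ T.edges)
    (hE₀ : LiesOnEdge 𝒯₀ E) : ∃ E₀ ∈ S.edges, E.carrier ⊆ Edge.carrier E₀ := by
  obtain ⟨E₁, ⟨S', hS', hE₁⟩, hsub⟩ := hE₀
  by_cases hSS : S = S'
  · subst hSS
    exact ⟨E₁, hE₁, hsub⟩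
  have c := (edge_carrier_subset hE).trans hTS
  have c' := hsub.trans (edge_carrier_subset hE₁)
  have cc := Set.subset_inter c c'
  induction E using Sym2.ind with | _ x y =>
  rw [Edge.carrier_mk] at c c' cc
  have hx := left_mem_segment ℝ x y
  have hy := right_mem_segment ℝ x y
  obtain ⟨E₀, hE₀, e⟩ := h₀.exists_edge_of_subset hS hS' hSS (hT.ne_of_mem_edges hE) (c hx) (c' hx)
    (c hy) (c' hy)
  exact ⟨E₀, hE₀.1, by rw [Edge.carrier_mk, ← e]; exact cc⟩

theorem IsRefinement.exists_isCorner (h₀ : IsMeshOn Ω 𝒯₀) {𝒯 : Set (Elem d)}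
    (h : IsRefinement 𝒯₀ 𝒯) {T : Elem d} (hT : T ∈ 𝒯) {E₁ E₂ : Edge d} (hE₁ : E₁ ∈ T.edges)
    (hE₂ : E₂ ∈ T.edges) (hne : E₁ ≠ E₂) (h₁ : LiesOnEdge 𝒯₀ E₁) (h₂ : LiesOnEdge 𝒯₀ E₂) :
    ∃ S ∈ ⋃ S ∈ 𝒯₀, S.orders, S.IsCorner T := by
  obtain ⟨S, hS, hST⟩ := h.ancestor T hT
  have hTS := carrier_subset_of_reflTransGen hST
  have nT := h.isConforming.nondegenerate T hT
  obtain ⟨F₁, hF₁, f₁⟩ := h₀.exists_edge_of_liesOnEdge hS nT hTS hE₁ h₁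
  obtain ⟨F₂, hF₂, f₂⟩ := h₀.exists_edge_of_liesOnEdge hS nT hTS hE₂ h₂
  obtain ⟨S', hS', hc⟩ :=
    Elem.exists_isCorner (h₀.nondegenerate S hS) nT hE₁ hE₂ hne hF₁ hF₂ f₁ f₂
  exact ⟨S', Set.mem_biUnion hS hS', hc⟩

open Classical in
-- At most two of the elements lie in any one initial triangle. The number of initial triangles
-- enters because in space arbitrarily many of them may share an edge.
theorem IsRefinement.card_common_edge_le (h₀ : IsMeshOn Ω 𝒯₀) {𝒯 : Set (Elem d)}
    (h : IsRefinement 𝒯₀ 𝒯) {ι : Type*} (s : Finset ι) (τ : ι → Elem d) (hτ : ∀ i, τ i ∈ 𝒯)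
    (hinj : Function.Injective τ) (E : Edge d) (hE : ∀ i ∈ s, E ∈ (τ i).edges) :
    s.card ≤ 2 * h₀.finite.toFinset.card := by
  choose S hS hST using fun i => h.ancestor (τ i) (hτ i)
  refine Finset.card_le_mul_card_image_of_maps_to (f := S)
    (fun i _ => h₀.finite.mem_toFinset.2 (hS i)) 2 fun U _ => ?_
  by_contra! hlt
  obtain ⟨i, j, k, hi, hj, hk, hij, hik, hjk⟩ := Finset.two_lt_card_iff.1 hlt
  rw [Finset.mem_filter] at hi hj hk
  have sub : ∀ i, S i = U → (τ i).carrier ⊆ U.carrier := by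
    rintro i rfl
    exact carrier_subset_of_reflTransGen (hST i)
  rcases h.isConforming.exists_eq_of_common_edge (hτ i) (hτ j) (hτ k) (sub i hi.2) (sub j hj.2)
    (sub k hk.2) (hE i hi.1) (hE j hj.1) (hE k hk.1) with e | e | e
  exacts [hij (hinj e), hik (hinj e), hjk (hinj e)]

open Classical in
/-- The number of different reference edges in a chain is bounded. -/
theorem IsRefinement.exists_chain_bound (h₀ : IsMeshOn Ω 𝒯₀) (hgen : ∀ T ∈ 𝒯₀, T.gen = 0) :
    ∃ C : ℕ, ∀ 𝒯, IsRefinement 𝒯₀ 𝒯 → ∀ (n : ℕ) (τ : Fin n → Elem d),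
      (∀ i, τ i ∈ 𝒯) → Function.Injective τ →
      (∀ i j : Fin n, (j : ℕ) = (i : ℕ) + 1 → IsRefNeighbor 𝒯 (τ i) (τ j)) →
      (∀ i j : Fin n, (τ i).gen = (τ j).gen) → n ≤ C := by
  have hfin : (⋃ S ∈ 𝒯₀, S.orders).Finite := h₀.finite.biUnion fun S _ => S.finite_orders
  refine ⟨2 * h₀.finite.toFinset.card * (hfin.toFinset.card + 2), fun 𝒯 h n τ hτ hinj hN hg => ?_⟩
  rcases Nat.eq_zero_or_pos n with rfl | hn
  · exact Nat.zero_le _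
  set last : Fin n := ⟨n - 1, by omega⟩ with hlast
  set first : Fin n := ⟨0, hn⟩
  have link : ∀ i j : Fin n, (j : ℕ) = (i : ℕ) + 1 →
      (τ j).refEdge = (τ i).refEdge ∨ LiesOnEdge 𝒯₀ (τ i).refEdge := fun i j hij =>
    h.refEdge_eq_or_liesOnEdge h₀ hgen (hN i j hij) (hg i j)
  -- Either the reference edge changes at some later link, and at the first such link it is seen to
  -- lie on an initial edge, or it stays the same up to the end.
  have forward : ∀ m (i : Fin n), (i : ℕ) + m = n - 1 →
      LiesOnEdge 𝒯₀ (τ i).refEdge ∨ (τ i).refEdge = (τ last).refEdge := by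
    intro m
    induction m with
    | zero =>
      intro i hi
      exact .inr (by rw [show i = last from Fin.ext (by simpa [hlast] using hi)])
    | succ m ih =>
      intro i hi
      rcases link i ⟨i + 1, by omega⟩ rfl with e | e
      · rw [← e]
        exact ih _ (by simp; omega)
      · exact .inl e
  have backward : ∀ k (hk : k < n), (τ ⟨k, hk⟩).refEdge = (τ first).refEdge ∨
      (τ ⟨k, hk⟩).refEdge = (τ last).refEdge ∨
      ∃ j, (∃ S ∈ ⋃ S ∈ 𝒯₀, S.orders, S.IsCorner (τ j)) ∧
        (τ j).refEdge = (τ ⟨k, hk⟩).refEdge := by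
    intro k
    induction k with
    | zero => intro hk; exact .inl rfl
    | succ k ih =>
      intro hk
      have hk' : k < n := by omega
      by_cases e : (τ ⟨k + 1, hk⟩).refEdge = (τ ⟨k, hk'⟩).refEdge
      · rw [e]; exact ih hk'
      -- At a change of reference edge, element `k + 1` has the old one as an edge, and that lies on
      -- an initial edge. Unless the new one is already the last one, it lies on an initial edge
      -- too, which puts the element into a corner.
      · have h₁ := (link ⟨k, hk'⟩ ⟨k + 1, hk⟩ rfl).resolve_left e
        rcases forward (n - 1 - (k + 1)) ⟨k + 1, hk⟩ (by simp; omega) with h₂ | h₂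
        · refine .inr (.inr ⟨⟨k + 1, hk⟩, ?_, rfl⟩)
          have hE := (h.isConforming.mem_edges_of_sharesEdge (hN ⟨k, hk'⟩ ⟨k + 1, hk⟩ rfl)).2
          exact h.exists_isCorner h₀ (hτ _) hE (by simp [edges, refEdge]) (Ne.symm e) h₁ h₂
        · exact .inr (.inl h₂)
  set J : Finset (Fin n) := {j | ∃ S ∈ ⋃ S ∈ 𝒯₀, S.orders, S.IsCorner (τ j)} with hJ
  have hJcard : J.card ≤ hfin.toFinset.card := by
    have hS : ∀ j : Fin n, ∃ S, j ∈ J → S ∈ (⋃ S ∈ 𝒯₀, S.orders) ∧ S.IsCorner (τ j) := by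
      intro j
      by_cases hj : j ∈ J
      · obtain ⟨S, h1, h2⟩ := (Finset.mem_filter.1 hj).2
        exact ⟨S, fun _ => ⟨h1, h2⟩⟩
      · exact ⟨τ j, fun h => absurd h hj⟩
    choose S hS using hS
    refine Finset.card_le_card_of_injOn S (fun j hj => hfin.mem_toFinset.2 (hS j hj).1) ?_
    intro i hi j hj e
    have h1 := (hS i hi).2
    rw [e] at h1
    exact hinj (h.isConforming.eq_of_isCorner (hτ i) (hτ j) h1 (hS j hj).2)
  -- All reference edges of the chain are among these: the first, the last, and those of the corner
  -- elements.
  set I : Finset (Edge d) :=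
    insert (τ first).refEdge (insert (τ last).refEdge (J.image fun j => (τ j).refEdge)) with hI
  have hIcard : I.card ≤ hfin.toFinset.card + 2 := by
    have h1 := Finset.card_insert_le (τ first).refEdge
      (insert (τ last).refEdge (J.image fun j => (τ j).refEdge))
    have h2 := Finset.card_insert_le (τ last).refEdge (J.image fun j => (τ j).refEdge)
    have h3 : (J.image fun j => (τ j).refEdge).card ≤ J.card := Finset.card_image_le
    rw [← hI] at h1
    omega
  have hcount := Finset.card_le_mul_card_image_of_maps_to (s := Finset.univ) (t := I)
    (f := fun i => (τ i).refEdge) ?_ (2 * h₀.finite.toFinset.card) ?_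
  · rw [Finset.card_univ, Fintype.card_fin] at hcount
    exact hcount.trans (Nat.mul_le_mul_left _ hIcard)
  · rintro ⟨k, hk⟩ -
    rw [hI, Finset.mem_insert, Finset.mem_insert, Finset.mem_image]
    rcases backward k hk with e | e | ⟨j, hj, e⟩
    · exact .inl e
    · exact .inr (.inl e)
    · exact .inr (.inr ⟨j, by simpa [hJ] using hj, e⟩)
  · intro E _
    refine h.card_common_edge_le h₀ _ τ hτ hinj E fun i hi => ?_
    rw [← (Finset.mem_filter.1 hi).2]
    simp [edges, refEdge]

end Initial

end NVB

/-! ### The theorem -/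

theorem proposition9 (d : ℕ) (Ω : Set (Point d)) (𝒯₀ : Set (Elem d))
    (h𝒯₀ : IsMeshOn Ω 𝒯₀) (hgen : ∀ T ∈ 𝒯₀, T.gen = 0) :
    -- (i)
    (∃ c > (0 : ℝ), ∃ C > (0 : ℝ), ∀ 𝒯, RefineNVB 𝒯₀ 𝒯 → ∀ T ∈ 𝒯,
      c * (2 : ℝ) ^ (-(T.gen : ℝ) / 2) ≤ Real.sqrt T.area ∧
      Real.sqrt T.area ≤ T.diam ∧
      T.diam ≤ C * (2 : ℝ) ^ (-(T.gen : ℝ) / 2)) ∧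
    -- (ii)
    (∀ 𝒯, RefineNVB 𝒯₀ 𝒯 → ∀ T₁ T₂ E, SharesEdge 𝒯 T₁ T₂ E →
      |(T₁.gen : ℤ) - (T₂.gen : ℤ)| ≤ 2) ∧
    -- (iii)
    (∀ 𝒯, RefineNVB 𝒯₀ 𝒯 → ∀ T T', IsRefNeighbor 𝒯 T T' → T.gen < T'.gen →
      CompatiblyDivisible 𝒯 T T' ∧ T'.gen = T.gen + 1) ∧
    -- (iv)
    (∀ 𝒯, RefineNVB 𝒯₀ 𝒯 → ∀ S ∈ 𝒯₀, ∀ T₁ T₂ E, IsSuccessor S T₁ → IsSuccessor S T₂ →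
      SharesEdge 𝒯 T₁ T₂ E → T₁.gen = T₂.gen → CompatiblyDivisible 𝒯 T₁ T₂) ∧
    -- (v)
    (∀ 𝒯, RefineNVB 𝒯₀ 𝒯 → ∀ S₁ S₂, CompatiblyDivisible 𝒯₀ S₁ S₂ →
      ∀ T₁ T₂ E, IsSuccessor S₁ T₁ → IsSuccessor S₂ T₂ →
      SharesEdge 𝒯 T₁ T₂ E → T₁.gen = T₂.gen → CompatiblyDivisible 𝒯 T₁ T₂) ∧
    -- (vi)
    (∀ 𝒯, RefineNVB 𝒯₀ 𝒯 → ∀ T T', IsRefNeighbor 𝒯 T T' → T'.gen = T.gen →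
      ¬ CompatiblyDivisible 𝒯 T T' →
      ∃ E₀ ∈ meshEdges 𝒯₀, T.refEdge.carrier ⊆ Edge.carrier E₀) ∧
    -- (vii)
    (∃ Cchain : ℕ, ∀ 𝒯, RefineNVB 𝒯₀ 𝒯 → ∀ (n : ℕ) (τ : Fin n → Elem d),
      (∀ i, τ i ∈ 𝒯) → Function.Injective τ →
      (∀ i j : Fin n, (j : ℕ) = (i : ℕ) + 1 → IsRefNeighbor 𝒯 (τ i) (τ j)) →
      (∀ i j : Fin n, (τ i).gen = (τ j).gen) → n ≤ Cchain) ∧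
    -- (i) and (ii) for modified newest vertex bisection
    (∃ c > (0 : ℝ), ∃ C > (0 : ℝ), ∀ 𝒯, RefineMNVB 𝒯₀ 𝒯 → ∀ T ∈ 𝒯,
      c * (2 : ℝ) ^ (-(T.gen : ℝ) / 2) ≤ Real.sqrt T.area ∧
      Real.sqrt T.area ≤ T.diam ∧
      T.diam ≤ C * (2 : ℝ) ^ (-(T.gen : ℝ) / 2)) ∧
    (∀ 𝒯, RefineMNVB 𝒯₀ 𝒯 → ∀ T₁ T₂ E, SharesEdge 𝒯 T₁ T₂ E →
      |(T₁.gen : ℤ) - (T₂.gen : ℤ)| ≤ 2) := by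
  have hN : ∀ 𝒯, RefineNVB 𝒯₀ 𝒯 → IsRefinement 𝒯₀ 𝒯 := fun 𝒯 h => h.isRefinement h𝒯₀.isConforming
  have hM : ∀ 𝒯, RefineMNVB 𝒯₀ 𝒯 → IsRefinement 𝒯₀ 𝒯 := fun 𝒯 h => h.isRefinement h𝒯₀.isConforming
  refine ⟨exists_size_bounds h𝒯₀ hgen hN, ?_, ?_, ?_, ?_, ?_, ?_,
    exists_size_bounds h𝒯₀ hgen hM, ?_⟩
  · intro 𝒯 h T₁ T₂ E hE
    exact (hN 𝒯 h).abs_gen_sub_le h𝒯₀ hgen hE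
  · intro 𝒯 h T T' hT hlt
    exact (hN 𝒯 h).refNeighbor_of_gen_lt h𝒯₀ hgen hT hlt
  · intro 𝒯 h S hS T₁ T₂ E h₁ h₂ hE hg
    exact (hN 𝒯 h).compatiblyDivisible_of_same_ancestor h𝒯₀ hgen hS h₁ h₂ hE hg
  · intro 𝒯 h S₁ S₂ hS T₁ T₂ E h₁ h₂ hE hg
    exact (hN 𝒯 h).compatiblyDivisible_of_ancestors h𝒯₀ hgen hS h₁ h₂ hE hg
  · intro 𝒯 h T T' hT hg hc
    exact (hN 𝒯 h).refEdge_subset_of_not_compatiblyDivisible h𝒯₀ hgen hT hg hc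
  · obtain ⟨C, hC⟩ := IsRefinement.exists_chain_bound h𝒯₀ hgen
    exact ⟨C, fun 𝒯 h => hC 𝒯 (hN 𝒯 h)⟩
  · intro 𝒯 h T₁ T₂ E hE
    exact (hM 𝒯 h).abs_gen_sub_le h𝒯₀ hgen hE
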